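/- **Setting.** Let $n,j_1,j_2\ge 1$ be integers and let $\mathbb T_n=(\mathbb Z/2nj_1\mathbb Z)\times(\mathbb Z/2nj_2\mathbb Z)$ be the square lattice torus, with its faces coloured black and white like a chessboard. Let $c\in[\sqrt3,2]$, $q=(c^2-2)^2$, and let $\lambda$ be a real number with $\sqrt q=2\cos\lambda$. *Six-vertex model.* An arrow configuration $\alpha$ assigns an arrow to every edge so that exactly two arrows point towards each vertex. Its probability is $c^{N(\alpha)}/Z_n$, where $N(\alpha)$ is the number of vertices around which arrows alternate between incoming and outgoing, and $Z_n=\sum_\alpha c^{N(\alpha)}$. Identify the faces with the points of the box $\{-nj_1+1,\dots,nj_1\}\times\{-nj_2+1,\dots,nj_2\}$ via their lower left corners, and call a directed path in the dual graph *admissible* if it stays in the box, i.e. never takes a step around the torus between the $i$-th coordinates $nj_i$ and $-nj_i+1$ ($i=1,2$). Fix a white face $u_0$; let $h(u_0)=\pm1$ with probability $\tfrac12$ each, independently of $\alpha$, and for every face $u$ let $h(u)-h(u_0)$ be the number of arrows of $\alpha$ crossing an admissible path from $u_0$ to $u$ from right to left, minus the number crossing it from left to right (this does not depend on the path). Put $\sigma(u)=i^{h(u)}$,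 and let $\mu_n$ be the law of $(\alpha,h)$. *Loop model.* A fully packed loop configuration $L$ is obtained by connecting, at each vertex, the four incident half-edges in pairs in one of the two noncrossing ways; the resulting unoriented closed loops traverse each edge exactly once. Let $|L|$ be the number of loops, and $|L_{\rm nctr}|$ the number of loops that are noncontractible on the torus. Let $$\phi_n(L)=\frac1{Z_n}\sqrt q^{\,|L|}\Big(\frac2{\sqrt q}\Big)^{|L_{\rm nctr}|}.$$ For an oriented version $\vec\ell$ of a loop $\ell$, with $-\vec\ell$ the reversed one, let ${\rm w}(\vec\ell)$ be $\tfrac14$ times the number of left turns minus the number of right turns of $\vec\ell$. *Zipper.* Let $u_1,\dots,u_{2k}$ be black faces and $v_1,\dots,v_{2l}$ white faces ($k,l\ge0$, repetitions allowed). Declare any $k+l$ of these $2k+2l$ faces (counted with index) sources and the others sinks, join the sources to the sinks in pairs by $k+l$ admissible directed paths, each from a source to a sink, and let $\Gamma$ be the multiset of directed edges of $\mathbb T_n$ that cross these paths from right to left. For a set $H$ of directed edges, with $-H$ the set of reversed edges, put $\epsilon(H)=i^{|\Gamma\cap H|}(-i)^{|\Gamma\cap(-H)|}$ (counting multiplicities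 in $\Gamma$), and for a loop $\ell$ put $$\rho(\ell)=\frac{e^{i\lambda {\rm w}(\vec\ell)}\epsilon(\vec\ell)+e^{i\lambda {\rm w}(-\vec\ell)}\epsilon(-\vec\ell)}{e^{i\lambda {\rm w}(\vec\ell)}+e^{i\lambda {\rm w}(-\vec\ell)}}.$$ **Lemma.** Let $s$ be the number of white sinks. Then $$\mathbf E_{\mu_n}\Big[\prod_{i=1}^{2k}\sigma(u_i)\prod_{j=1}^{2l}\sigma(v_j)\Big]=(-1)^s\,\mathbf E_{\phi_n}\Big[\prod_{\ell\in L}\rho(\ell)\Big].$$ -/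

import Mathlib

noncomputable section

namespace SixVertex

/-- The vertices of the square lattice torus `(ℤ / 2N₁ℤ) × (ℤ / 2N₂ℤ)`. -/
abbrev Vertex (N₁ N₂ : ℕ) : Type := ZMod (2 * N₁) × ZMod (2 * N₂)

/-- The faces of the torus. The face `(x, y)` is the unit square with lower left corner `(x, y)`
(and upper right corner `(x + 1, y + 1)`). -/
abbrev Face (N₁ N₂ : ℕ) : Type := ZMod (2 * N₁) × ZMod (2 * N₂)

/-- Lattice unit vectors: `0, 1, 2, 3` stand for east, north, west, south, so that `d + 1` is `d`
turned left by a right angle, `d + 3` is `d` turned right, and `d + 2` is opposite to `d`. -/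
def unitVec : Fin 4 → ℤ × ℤ := ![(1, 0), (0, 1), (-1, 0), (0, -1)]

/-- The neighbour of a vertex (or of a face) in direction `d`. -/
def move {N₁ N₂ : ℕ} (v : ZMod (2 * N₁) × ZMod (2 * N₂)) (d : Fin 4) :
    ZMod (2 * N₁) × ZMod (2 * N₂) :=
  (v.1 + ((unitVec d).1 : ZMod (2 * N₁)), v.2 + ((unitVec d).2 : ZMod (2 * N₂)))

/-- A directed edge of the torus: `(v, d)` is the edge that leaves `v` in direction `d`. -/
abbrev DEdge (N₁ N₂ : ℕ) : Type := Vertex N₁ N₂ × Fin 4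

/-- The end point of a directed edge. -/
def DEdge.head {N₁ N₂ : ℕ} (x : DEdge N₁ N₂) : Vertex N₁ N₂ := move x.1 x.2

/-- The same edge with the opposite direction. -/
def DEdge.rev {N₁ N₂ : ℕ} (x : DEdge N₁ N₂) : DEdge N₁ N₂ := (x.head, x.2 + 2)

open Classical in
/-- `-H`, the set of all reversed edges of `H`. -/
def reverse {N₁ N₂ : ℕ} (H : Finset (DEdge N₁ N₂)) : Finset (DEdge N₁ N₂) :=
  H.image DEdge.rev

/-! ### Arrow configurations and the six-vertex weights -/

open Classical in
/-- An arrow configuration, identified with the set of its directed edges: every edge carries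
exactly one arrow, and exactly two arrows point towards each vertex. -/
def IsArrowConfig {N₁ N₂ : ℕ} (α : Finset (DEdge N₁ N₂)) : Prop :=
  (∀ x : DEdge N₁ N₂, Xor (x ∈ α) (x.rev ∈ α)) ∧
    ∀ v : Vertex N₁ N₂, (α.filter fun x => x.head = v).card = 2

open Classical in
/-- The finite set of all arrow configurations. -/
def arrowConfigs (N₁ N₂ : ℕ) [NeZero N₁] [NeZero N₂] : Finset (Finset (DEdge N₁ N₂)) :=
  Finset.univ.filter IsArrowConfig

open Classical in
/-- The number of vertices around which the arrows alternate between incoming and outgoing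
(the vertices of type 3a or 3b). -/
def numAlternating {N₁ N₂ : ℕ} [NeZero N₁] [NeZero N₂] (α : Finset (DEdge N₁ N₂)) : ℕ :=
  (Finset.univ.filter fun v : Vertex N₁ N₂ =>
    ∀ d : Fin 4, (v, d) ∈ α ↔ (v, d + 1) ∉ α).card

/-- The partition function of the six-vertex model. -/
def partitionFunction (N₁ N₂ : ℕ) [NeZero N₁] [NeZero N₂] (c : ℝ) : ℝ :=
  ∑ α ∈ arrowConfigs N₁ N₂, c ^ numAlternating α

/-! ### Faces, dual paths and the height function -/

/-- A chessboard colouring, given by its set of black faces (the other faces are white): faces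
that share an edge have different colours. -/
def IsChessboard {N₁ N₂ : ℕ} (black : Set (Face N₁ N₂)) : Prop :=
  ∀ (f : Face N₁ N₂) (d : Fin 4), move f d ∈ black ↔ f ∉ black

/-- With the coordinates of the torus represented in
`{-N₁ + 1, …, N₁} × {-N₂ + 1, …, N₂}`, the step from the face `f` in direction `d` leaves this
box: it goes from `i`-th coordinate `Nᵢ` to `-Nᵢ + 1` or vice versa, around the torus. -/
def CrossesCut {N₁ N₂ : ℕ} (f : Face N₁ N₂) (d : Fin 4) : Prop :=
  (d = 0 ∧ f.1 = (N₁ : ZMod (2 * N₁))) ∨ (d = 2 ∧ f.1 = -(N₁ : ZMod (2 * N₁)) + 1) ∨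
  (d = 1 ∧ f.2 = (N₂ : ZMod (2 * N₂))) ∨ (d = 3 ∧ f.2 = -(N₂ : ZMod (2 * N₂)) + 1)

/-- Directed paths in the dual graph, from one face to another, all of whose steps stay inside
the box. -/
inductive DualPath (N₁ N₂ : ℕ) : Face N₁ N₂ → Face N₁ N₂ → Type
  | nil (f : Face N₁ N₂) : DualPath N₁ N₂ f f
  | cons (f : Face N₁ N₂) (d : Fin 4) (g : Face N₁ N₂) (h : ¬ CrossesCut f d)
      (p : DualPath N₁ N₂ (move f d) g) : DualPath N₁ N₂ f g

/-- The primal edge crossed by the dual step from the face `f` in direction `d`, directed so that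
it crosses this step from right to left. -/
def crossedEdge {N₁ N₂ : ℕ} (f : Face N₁ N₂) (d : Fin 4) : DEdge N₁ N₂ :=
  ((![(f.1 + 1, f.2), (f.1 + 1, f.2 + 1), (f.1, f.2 + 1), (f.1, f.2)] :
      Fin 4 → Vertex N₁ N₂) d, d + 1)

/-- The directed edges that cross a dual path from right to left, with multiplicity. -/
def DualPath.crossings {N₁ N₂ : ℕ} :
    {f g : Face N₁ N₂} → DualPath N₁ N₂ f g → Multiset (DEdge N₁ N₂)
  | _, _, .nil _ => 0
  | _, _, .cons f d _ _ p => crossedEdge f d ::ₘ p.crossings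

open Classical in
/-- The number of arrows of `α` that cross the path from right to left, minus the number of those
that cross it from left to right. -/
def DualPath.flux {N₁ N₂ : ℕ} {f g : Face N₁ N₂} (p : DualPath N₁ N₂ f g)
    (α : Finset (DEdge N₁ N₂)) : ℤ :=
  (p.crossings.countP fun x => x ∈ α : ℤ) - (p.crossings.countP fun x => x.rev ∈ α : ℤ)

/-- Concatenation of paths. -/
def DualPath.append {N₁ N₂ : ℕ} :
    {f g h : Face N₁ N₂} → DualPath N₁ N₂ f g → DualPath N₁ N₂ g h → DualPath N₁ N₂ f h
  | _, _, _, .nil _, q => q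
  | _, _, _, .cons f d _ hd p, q => .cons f d _ hd (p.append q)

theorem move_zero {N₁ N₂ : ℕ} (f : Face N₁ N₂) : move f 0 = (f.1 + 1, f.2) := by
  simp [move, unitVec]

theorem move_one {N₁ N₂ : ℕ} (f : Face N₁ N₂) : move f 1 = (f.1, f.2 + 1) := by
  simp [move, unitVec]

theorem move_two {N₁ N₂ : ℕ} (f : Face N₁ N₂) : move f 2 = (f.1 - 1, f.2) := by
  simp [move, unitVec, sub_eq_add_neg]

theorem move_three {N₁ N₂ : ℕ} (f : Face N₁ N₂) : move f 3 = (f.1, f.2 - 1) := by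
  simp [move, unitVec, sub_eq_add_neg]

/-- A step that stays inside the box. -/
theorem DualPath.nonempty_step {N₁ N₂ : ℕ} (f g : Face N₁ N₂) (d : Fin 4)
    (h : ¬ CrossesCut f d) (hg : move f d = g) : Nonempty (DualPath N₁ N₂ f g) := by
  subst hg
  exact ⟨.cons f d _ h (.nil _)⟩

theorem cut_ne {N k : ℕ} (hk : k + 1 < 2 * N) :
    -(N : ZMod (2 * N)) + 1 + (k : ZMod (2 * N)) ≠ N ∧
    -(N : ZMod (2 * N)) + 1 + ((k + 1 : ℕ) : ZMod (2 * N)) ≠ -(N : ZMod (2 * N)) + 1 := by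
  have h2 : ((2 * N : ℕ) : ZMod (2 * N)) = 0 := ZMod.natCast_self _
  have hne : ((k + 1 : ℕ) : ZMod (2 * N)) ≠ 0 := by
    intro h
    rw [ZMod.natCast_eq_zero_iff] at h
    exact absurd (Nat.le_of_dvd (Nat.succ_pos k) h) (by omega)
  push_cast at h2 hne ⊢
  constructor
  · intro h
    apply hne
    linear_combination h + h2
  · intro h
    apply hne
    linear_combination h

theorem cut_surj (N : ℕ) [NeZero N] (x : ZMod (2 * N)) :
    ∃ k : ℕ, k < 2 * N ∧ x = -(N : ZMod (2 * N)) + 1 + (k : ZMod (2 * N)) :=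
  ⟨(x + N - 1).val, ZMod.val_lt _, by rw [ZMod.natCast_zmod_val]; ring⟩

/-- Any two faces are connected by a path inside the box. -/
theorem DualPath.nonempty {N₁ N₂ : ℕ} [NeZero N₁] [NeZero N₂] (f g : Face N₁ N₂) :
    Nonempty (DualPath N₁ N₂ f g) := by
  have trans : ∀ {f g h : Face N₁ N₂}, Nonempty (DualPath N₁ N₂ f g) →
      Nonempty (DualPath N₁ N₂ g h) → Nonempty (DualPath N₁ N₂ f h) :=
    fun ⟨p⟩ ⟨q⟩ => ⟨p.append q⟩
  have hor : ∀ (y : ZMod (2 * N₂)) (k : ℕ), k < 2 * N₁ →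
      Nonempty (DualPath N₁ N₂ (-(N₁ : ZMod (2 * N₁)) + 1, y) (-(N₁ : ZMod (2 * N₁)) + 1 + k, y)) ∧
      Nonempty (DualPath N₁ N₂ (-(N₁ : ZMod (2 * N₁)) + 1 + k, y) (-(N₁ : ZMod (2 * N₁)) + 1, y)) := by
    intro y k
    induction k with
    | zero => intro _; simpa using ⟨DualPath.nil _⟩
    | succ k ih =>
      intro hk
      obtain ⟨h1, h2⟩ := ih (by omega)
      obtain ⟨e1, e2⟩ := cut_ne hk
      refine ⟨trans h1 (nonempty_step _ _ 0 (by simpa [CrossesCut] using e1) ?_),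
        trans (nonempty_step _ _ 2 (by simpa [CrossesCut] using e2) ?_) h2⟩
      · rw [move_zero]; push_cast; ext <;> simp; ring
      · rw [move_two]; push_cast; ext <;> simp; ring
  have ver : ∀ (x : ZMod (2 * N₁)) (k : ℕ), k < 2 * N₂ →
      Nonempty (DualPath N₁ N₂ (x, -(N₂ : ZMod (2 * N₂)) + 1) (x, -(N₂ : ZMod (2 * N₂)) + 1 + k)) ∧
      Nonempty (DualPath N₁ N₂ (x, -(N₂ : ZMod (2 * N₂)) + 1 + k) (x, -(N₂ : ZMod (2 * N₂)) + 1)) := by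
    intro x k
    induction k with
    | zero => intro _; simpa using ⟨DualPath.nil _⟩
    | succ k ih =>
      intro hk
      obtain ⟨h1, h2⟩ := ih (by omega)
      obtain ⟨e1, e2⟩ := cut_ne hk
      refine ⟨trans h1 (nonempty_step _ _ 1 (by simpa [CrossesCut] using e1) ?_),
        trans (nonempty_step _ _ 3 (by simpa [CrossesCut] using e2) ?_) h2⟩
      · rw [move_one]; push_cast; ext <;> simp; ring
      · rw [move_three]; push_cast; ext <;> simp; ring
  obtain ⟨f₁, f₂⟩ := f
  obtain ⟨g₁, g₂⟩ := g
  obtain ⟨k, hk, rfl⟩ := cut_surj N₁ f₁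
  obtain ⟨l, hl, rfl⟩ := cut_surj N₂ f₂
  obtain ⟨m, hm, rfl⟩ := cut_surj N₁ g₁
  obtain ⟨p, hp, rfl⟩ := cut_surj N₂ g₂
  exact trans (trans (hor _ k hk).2 (hor _ m hm).1) (trans (ver _ l hl).2 (ver _ p hp).1)

/-- The height function of the arrow configuration `α` with value `b` at the face `u₀`: the height
at `u` is `b` plus the flux of `α` through a path from `u₀` to `u` inside the box. (As `α` is a
conservative flow and the box is simply connected, the path does not matter.) -/
def height {N₁ N₂ : ℕ} [NeZero N₁] [NeZero N₂] (u₀ : Face N₁ N₂) (α : Finset (DEdge N₁ N₂))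
    (b : ℤ) (u : Face N₁ N₂) : ℤ :=
  b + (Classical.choice (DualPath.nonempty u₀ u)).flux α

/-- The spin `σ(u) = i ^ h(u)`. -/
def spin {N₁ N₂ : ℕ} [NeZero N₁] [NeZero N₂] (u₀ : Face N₁ N₂) (α : Finset (DEdge N₁ N₂))
    (b : ℤ) (u : Face N₁ N₂) : ℂ :=
  Complex.I ^ height u₀ α b u

/-- Expectation in the six-vertex model with parameter `c`. The random elements are the arrow
configuration `α`, with probability `c ^ N(α) / Z`, and, independently, the height `b = ± 1` at the
reference face, with probability `1 / 2` for each sign. -/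
def sixVertexExp {N₁ N₂ : ℕ} [NeZero N₁] [NeZero N₂] (c : ℝ)
    (X : Finset (DEdge N₁ N₂) → ℤ → ℂ) : ℂ :=
  ∑ α ∈ arrowConfigs N₁ N₂, ((c ^ numAlternating α / partitionFunction N₁ N₂ c : ℝ) : ℂ) *
    ∑ b ∈ ({1, -1} : Finset ℤ), 1 / 2 * X α b

/-! ### Fully packed loop configurations -/

/-- An unoriented fully packed configuration of noncrossing loops. It is given by the way the four
half-edges are connected in pairs at each vertex; there are two noncrossing ways: `true` connects
east with north and west with south, `false` connects north with west and south with east. -/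
abbrev LoopConfig (N₁ N₂ : ℕ) : Type := Vertex N₁ N₂ → Bool

/-- The half-edge to which the half-edge in direction `d` is connected. -/
def partner (b : Bool) (d : Fin 4) : Fin 4 :=
  if b then ![1, 0, 3, 2] d else ![3, 2, 1, 0] d

/-- The directed edge that follows `x` on the loop through `x`: having arrived at `x.head` through
the half-edge in direction `x.2 + 2`, the loop leaves through the half-edge connected to it. -/
def next {N₁ N₂ : ℕ} (L : LoopConfig N₁ N₂) (x : DEdge N₁ N₂) : DEdge N₁ N₂ :=
  (x.head, partner (L x.head) (x.2 + 2))

open Classical in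
/-- The oriented loop through the directed edge `x`, as a set of directed edges. -/
def orientedLoop {N₁ N₂ : ℕ} [NeZero N₁] [NeZero N₂] (L : LoopConfig N₁ N₂) (x : DEdge N₁ N₂) :
    Finset (DEdge N₁ N₂) :=
  Finset.univ.filter fun y => ∃ m : ℕ, (next L)^[m] x = y

open Classical in
/-- The unoriented loops of `L`. An unoriented loop is the unordered pair of its two oriented
versions. -/
def loops {N₁ N₂ : ℕ} [NeZero N₁] [NeZero N₂] (L : LoopConfig N₁ N₂) :
    Finset (Sym2 (Finset (DEdge N₁ N₂))) :=
  Finset.univ.image fun x : DEdge N₁ N₂ => s(orientedLoop L x, reverse (orientedLoop L x))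

/-- The displacement in `ℤ × ℤ`, the universal cover of the torus, of the lift of an oriented
loop. -/
def displacement {N₁ N₂ : ℕ} (o : Finset (DEdge N₁ N₂)) : ℤ × ℤ :=
  ∑ x ∈ o, unitVec x.2

/-- A loop is contractible on the torus if it lifts to a closed loop in the plane. -/
def IsContractible {N₁ N₂ : ℕ} (l : Sym2 (Finset (DEdge N₁ N₂))) : Prop :=
  ∀ o ∈ l, displacement o = 0

open Classical in
/-- The noncontractible loops of `L`. -/
def nctrLoops {N₁ N₂ : ℕ} [NeZero N₁] [NeZero N₂] (L : LoopConfig N₁ N₂) :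
    Finset (Sym2 (Finset (DEdge N₁ N₂))) :=
  (loops L).filter fun l => ¬ IsContractible l

/-- The cluster parameter `q = (c ^ 2 - 2) ^ 2`. -/
def clusterParam (c : ℝ) : ℝ := (c ^ 2 - 2) ^ 2

/-- The mass `√q ^ |L| * (2 / √q) ^ |L_nctr| / Z` of a loop configuration, with `Z` the partition
function of the six-vertex model. -/
def loopMass {N₁ N₂ : ℕ} [NeZero N₁] [NeZero N₂] (c : ℝ) (L : LoopConfig N₁ N₂) : ℝ :=
  √(clusterParam c) ^ (loops L).card * (2 / √(clusterParam c)) ^ (nctrLoops L).card /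
    partitionFunction N₁ N₂ c

/-- Expectation with respect to the loop measure. -/
def loopExp {N₁ N₂ : ℕ} [NeZero N₁] [NeZero N₂] (c : ℝ) (X : LoopConfig N₁ N₂ → ℂ) : ℂ :=
  ∑ L : LoopConfig N₁ N₂, (loopMass c L : ℂ) * X L

/-! ### The loop observable -/

/-- The total winding number of an oriented loop of `L`: a quarter of the number of its left turns
minus the number of its right turns. -/
def winding {N₁ N₂ : ℕ} (L : LoopConfig N₁ N₂) (o : Finset (DEdge N₁ N₂)) : ℝ :=
  (((o.filter fun x => (next L x).2 = x.2 + 1).card : ℝ) -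
    ((o.filter fun x => (next L x).2 = x.2 + 3).card : ℝ)) / 4

open Classical in
/-- `ε(H) = i ^ |Γ ∩ H| * (-i) ^ |Γ ∩ (-H)|`, where the edges of the zipper `Γ` are counted with
multiplicity. -/
def epsilon {N₁ N₂ : ℕ} (Γ : Multiset (DEdge N₁ N₂)) (H : Finset (DEdge N₁ N₂)) : ℂ :=
  Complex.I ^ (Γ.countP fun x => x ∈ H) * (-Complex.I) ^ (Γ.countP fun x => x ∈ reverse H)

/-- The factor `exp (i lam w(o))` of an oriented loop. -/
def phase {N₁ N₂ : ℕ} (lam : ℝ) (L : LoopConfig N₁ N₂) (o : Finset (DEdge N₁ N₂)) : ℂ :=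
  Complex.exp (Complex.I * (lam : ℂ) * (winding L o : ℂ))

/-- The weight `ρ(l)` of an unoriented loop `l` of `L` with oriented versions `o` and `o'`. -/
def rho {N₁ N₂ : ℕ} (lam : ℝ) (Γ : Multiset (DEdge N₁ N₂)) (L : LoopConfig N₁ N₂) :
    Sym2 (Finset (DEdge N₁ N₂)) → ℂ :=
  Sym2.lift ⟨fun o o' =>
    (phase lam L o * epsilon Γ o + phase lam L o' * epsilon Γ o') / (phase lam L o + phase lam L o'),
    fun _ _ => congrArg₂ (· / ·) (add_comm _ _) (add_comm _ _)⟩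

/-- The zipper of a family of paths: the directed edges that cross the paths from right to
left. -/
def zipper {N₁ N₂ m : ℕ} {f g : Fin m → Face N₁ N₂} (γ : ∀ i, DualPath N₁ N₂ (f i) (g i)) :
    Multiset (DEdge N₁ N₂) :=
  ∑ i, (γ i).crossings

end SixVertex

end

/-!
# Spin correlations of the six-vertex model as loop expectations

The proof is the Baxter–Kelland–Wu coupling. Orient every loop of a loop configuration `L`. The
resulting arrows form an arrow configuration `α` that is coherent with `L`, and the product of the
phases `exp (i lam w)` of the oriented loops factors over the vertices, since a left or right turn
contributes `exp (± i lam / 4)`. For a fixed `α`, a vertex where the arrows do not alternate has a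
single coherent pairing of its half-edges, with one left and one right turn, and an alternating
vertex has two, with two left or two right turns. So the sum over all `L` coherent with `α` is
`(2 cos (lam / 2)) ^ N(α)` (`sum_phase_coherent`). If the sum over the two orientations of each loop
is carried out first, the factor of a loop is `2 cos lam = √q` if the loop is contractible and `2`
otherwise, which is the mass of `L`. The factor `ε` of the zipper is multiplicative over disjoint
sets of edges, so it passes through both computations, and in the second one it turns the factor of
each loop into `ρ` times this factor. This gives `loopExp_rho`. Since `c ^ 2 = 2 + √q`, the number
`2 cos (lam / 2)` is `± c`; the weights `ρ` depend on `lam` modulo `2 π` only, as loops have integer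
winding, so the sign may be taken to be positive.

The loop factors need the total winding of a loop to be `± 1` if the loop is contractible, and `0`
otherwise (`sum_turn_orientedLoop`). The midpoints of the edges of a loop form a self-avoiding
lattice polygon with the same total turning, and Hopf's proof of the Umlaufsatz applies to the lift
of this polygon to the plane: the tangent is deformed through secants, which never vanish. For a
noncontractible loop, the lift is periodic and the deformation ends with the secants over one
period, which are constant (`sum_turn_eq_zero`). For a contractible loop, the deformation ends with
the secants that start or end at the leftmost of the lowest points, which sweep out a half-plane
each (`sum_turn_eq_four`). Angles are kept track of by counting crossings of a ray.

On the other side, the arrows are a conservative flow, hence a gradient on the box, so the heights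
at the two ends of a path of the zipper differ by the flux through the path. As heights are odd
exactly at white faces, the product of the spins at the ends of a path is `i` to the power of this
flux, with an additional minus sign if its source is white (`spin_mul_spin`). There are as many
white sources as white sinks modulo `2`.
-/

namespace SixVertex

/-! ### The turning number of a lattice polygon -/

/-- The signed number of crossings of the ray `{(x, -1/2) | x > 0}` by the lattice step from `a` to
`b`, counted positively if the step goes upwards. It is meant for steps parallel to an axis. -/
def rayCross (a b : ℤ × ℤ) : ℤ :=
  if 0 < a.1 then (if 0 ≤ b.2 then 1 else 0) - (if 0 ≤ a.2 then 1 else 0) else 0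

theorem rayCross_add_unitVec_swap (a : ℤ × ℤ) (d : Fin 4) :
    rayCross (a + unitVec d) a = -rayCross a (a + unitVec d) := by
  obtain ⟨x, y⟩ := a
  fin_cases d <;> simp [rayCross, unitVec] <;> split_ifs <;> omega

/-- A parallelogram of lattice steps does not wind around the origin, unless the origin is one of
its corners. -/
theorem rayCross_parallelogram (a : ℤ × ℤ) (d d' : Fin 4) (h₁ : a ≠ 0)
    (h₂ : a + unitVec d' ≠ 0) (h₃ : a - unitVec d ≠ 0) (h₄ : a + unitVec d' - unitVec d ≠ 0) :
    rayCross a (a + unitVec d') + rayCross (a + unitVec d') (a + unitVec d' - unitVec d) =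
      rayCross a (a - unitVec d) + rayCross (a - unitVec d) (a + unitVec d' - unitVec d) := by
  obtain ⟨x, y⟩ := a
  fin_cases d <;> fin_cases d' <;>
    simp [rayCross, unitVec, Prod.ext_iff] at h₁ h₂ h₃ h₄ ⊢ <;> split_ifs <;> omega

/-- Direction `d'` is obtained from direction `d` by `r` left quarter turns, where `r` is `0`, `1`
or `-1`. -/
def IsTurn (d d' : Fin 4) (r : ℤ) : Prop :=
  r = 0 ∧ d' = d ∨ r = 1 ∧ d' = d + 1 ∨ r = -1 ∧ d' = d + 3

/-- The turn from direction `d` to direction `d'`, in quarter turns, is the increment of the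
direction as a number in `{0, 1, 2, 3}`, up to a multiple of `4` that is recorded by `rayCross`. -/
theorem IsTurn.eq_rayCross (d d' : Fin 4) {r : ℤ} (h : IsTurn d d' r) :
    r = ((d' : ℕ) : ℤ) - ((d : ℕ) : ℤ) +
      4 * (rayCross (unitVec d) (unitVec d + unitVec d') +
        rayCross (unitVec d + unitVec d') (unitVec d')) := by
  obtain ⟨rfl, h⟩ | ⟨rfl, h⟩ | ⟨rfl, h⟩ := h <;> rw [h] <;> clear h <;> revert d <;> decide

section Secants

variable {p : ℕ → ℤ × ℤ} {t : ℕ → Fin 4}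

/-- The contribution to the turning number of the step of the secant `p j - p i` that moves its end
point along the polygon. -/
def headCross (p : ℕ → ℤ × ℤ) (i j : ℕ) : ℤ := rayCross (p j - p i) (p (j + 1) - p i)

/-- The contribution to the turning number of the step of the secant `p j - p i` that moves its
starting point along the polygon. -/
def tailCross (p : ℕ → ℤ × ℤ) (i j : ℕ) : ℤ := rayCross (p j - p i) (p j - p (i + 1))

/-- The order in which both end points of a secant are moved does not matter. -/
theorem headCross_add_tailCross (hp : ∀ i, p (i + 1) = p i + unitVec (t i)) {i j : ℕ}
    (h₁ : p i ≠ p j) (h₂ : p i ≠ p (j + 1)) (h₃ : p (i + 1) ≠ p j) (h₄ : p (i + 1) ≠ p (j + 1)) :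
    headCross p i j + tailCross p i (j + 1) = tailCross p i j + headCross p (i + 1) j := by
  have e₁ : p (j + 1) - p i = p j - p i + unitVec (t j) := by rw [hp j]; abel
  have e₂ : p j - p (i + 1) = p j - p i - unitVec (t i) := by rw [hp i]; abel
  have e₃ : p (j + 1) - p (i + 1) = p j - p i + unitVec (t j) - unitVec (t i) := by
    rw [hp i, hp j]; abel
  have := rayCross_parallelogram (p j - p i) (t i) (t j) (sub_ne_zero.2 h₁.symm)
    (e₁ ▸ sub_ne_zero.2 h₂.symm) (e₂ ▸ sub_ne_zero.2 h₃.symm) (e₃ ▸ sub_ne_zero.2 h₄.symm)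
  simpa only [headCross, tailCross, e₁, e₂, e₃] using this

/-- If a lattice path comes back to its initial direction, its total number of quarter turns is four
times the signed number of times that its tangent crosses the ray; between consecutive steps, the
tangent is moved through the secant over both steps. -/
theorem sum_turn_eq (hp : ∀ i, p (i + 1) = p i + unitVec (t i)) {m : ℕ} (htm : t m = t 0)
    {r : ℕ → ℤ} (ht : ∀ i, IsTurn (t i) (t (i + 1)) (r i)) :
    ∑ i ∈ Finset.range m, r i =
      4 * ∑ i ∈ Finset.range m, (headCross p i (i + 1) + tailCross p i (i + 2)) := by
  have key : ∀ i, r i = ((t (i + 1) : ℕ) : ℤ) - ((t i : ℕ) : ℤ) +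
      4 * (headCross p i (i + 1) + tailCross p i (i + 2)) := by
    intro i
    have e₁ : p (i + 1) - p i = unitVec (t i) := by rw [hp i]; abel
    have e₂ : p (i + 2) - p i = unitVec (t i) + unitVec (t (i + 1)) := by
      rw [hp (i + 1), hp i]; abel
    have e₃ : p (i + 2) - p (i + 1) = unitVec (t (i + 1)) := by rw [hp (i + 1)]; abel
    simpa only [headCross, tailCross, e₁, e₂, e₃] using
      (ht i).eq_rayCross (t i) (t (i + 1))
  rw [Finset.sum_congr rfl fun i _ => key i, Finset.sum_add_distrib,
    Finset.sum_range_sub (fun i => ((t i : ℕ) : ℤ)), htm, Finset.mul_sum]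
  simp

/-- A self-avoiding periodic lattice path with nonzero period vector has total turning zero over one
period: its tangent is homotopic, through secants over more and more steps, to the constant
period vector. -/
theorem sum_turn_eq_zero (hp : ∀ i, p (i + 1) = p i + unitVec (t i)) {m : ℕ} (hm : 2 ≤ m)
    {D : ℤ × ℤ} (hD : D ≠ 0) (hper : ∀ i, p (i + m) = p i + D)
    (hinj : ∀ i j, i < j → j < i + m → p i ≠ p j) (htm : t m = t 0)
    {r : ℕ → ℤ} (ht : ∀ i, IsTurn (t i) (t (i + 1)) (r i)) :
    ∑ i ∈ Finset.range m, r i = 0 := by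
  rw [sum_turn_eq hp htm ht]
  have hne : ∀ i j, i < j → j ≤ i + m → p i ≠ p j := by
    intro i j hij hj
    rcases hj.lt_or_eq with hj | rfl
    · exact hinj i j hij hj
    · rw [hper]; simpa using hD
  -- the turning number of the secants over `k + 1` steps does not depend on `k`
  have hS : ∀ k, k + 2 ≤ m →
      ∑ i ∈ Finset.range m, (headCross p i (i + 1) + tailCross p i (i + 2)) =
      ∑ i ∈ Finset.range m, (headCross p i (i + k + 1) + tailCross p i (i + k + 2)) := by
    intro k
    induction k with
    | zero => intro _; rfl
    | succ k ih =>
      intro hk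
      rw [ih (by omega)]
      have hsq : ∀ i, headCross p i (i + (k + 1) + 1) + tailCross p i (i + (k + 1) + 2) =
          tailCross p i (i + k + 2) + headCross p (i + 1) (i + 1 + k + 1) := by
        intro i
        have := headCross_add_tailCross hp (i := i) (j := i + k + 2) (hne _ _ (by omega) (by omega))
          (hne _ _ (by omega) (by omega)) (hne _ _ (by omega) (by omega))
          (hne _ _ (by omega) (by omega))
        convert this using 3 <;> omega
      rw [Finset.sum_congr rfl fun i _ => hsq i, Finset.sum_add_distrib, Finset.sum_add_distrib,
        add_comm]
      congr 1
      have h0 := Finset.sum_range_succ (fun i => headCross p i (i + k + 1)) m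
      have h1 := Finset.sum_range_succ' (fun i => headCross p i (i + k + 1)) m
      have h2 : headCross p m (m + k + 1) = headCross p 0 (0 + k + 1) := by
        have e₁ := hper 0
        have e₂ := hper (k + 1)
        have e₃ := hper (k + 2)
        simp only [headCross]
        rw [show m + k + 1 = k + 1 + m by omega, show k + 1 + m + 1 = k + 2 + m by omega,
          show p m = p (0 + m) by simp, e₁, e₂, e₃]
        simp
      linarith
  obtain ⟨k, rfl⟩ : ∃ k, m = k + 2 := ⟨m - 2, by omega⟩
  rw [hS k le_rfl]
  -- secants over all but one step of a period
  have key : ∀ i, headCross p i (i + k + 1) + tailCross p i (i + k + 2) =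
      rayCross D (D - unitVec (t i)) - rayCross D (p (i + k + 1) - p i) := by
    intro i
    have e₁ : p (i + k + 2) - p i = D := by rw [show i + k + 2 = i + (k + 2) by omega, hper]; abel
    have e₂ : p (i + k + 2) - p (i + 1) = D - unitVec (t i) := by rw [← e₁, hp i]; abel
    have e₃ : D = p (i + k + 1) - p i + unitVec (t (i + k + 1)) := by
      rw [← e₁, hp (i + k + 1)]; abel
    have e₄ := rayCross_add_unitVec_swap (p (i + k + 1) - p i) (t (i + k + 1))
    rw [← e₃] at e₄
    rw [headCross, tailCross, e₁, e₂, e₄]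
    ring
  have key' : ∀ i, rayCross D (D - unitVec (t i)) =
      rayCross D (p (i + 1 + k + 1) - p (i + 1)) := by
    intro i
    congr 1
    rw [show i + 1 + k + 1 = i + (k + 2) by omega, hper, hp i]; abel
  rw [Finset.sum_congr rfl fun i _ => (key i).trans (by rw [key' i]),
    Finset.sum_range_sub (fun i => rayCross D (p (i + k + 1) - p i))]
  have : p (k + 2 + k + 1) - p (k + 2) = p (0 + k + 1) - p 0 := by
    have e₁ := hper 0
    have e₂ := hper (k + 1)
    rw [show k + 2 + k + 1 = k + 1 + (k + 2) by omega, e₂]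
    rw [zero_add] at e₁ ⊢
    rw [e₁]; abel
  rw [this]; simp

/-- Moving the starting point of a secant from `a` to `n`, before and after a step of its end
point. -/
theorem sum_tailCross_add_headCross (hp : ∀ i, p (i + 1) = p i + unitVec (t i)) {a j : ℕ} (n : ℕ)
    (han : a ≤ n) (h : ∀ i, a ≤ i → i ≤ n → p i ≠ p j)
    (h' : ∀ i, a ≤ i → i ≤ n → p i ≠ p (j + 1)) :
    ∑ i ∈ Finset.Ico a n, tailCross p i j + headCross p n j =
      headCross p a j + ∑ i ∈ Finset.Ico a n, tailCross p i (j + 1) := by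
  induction n, han using Nat.le_induction with
  | base => simp
  | succ n han ih =>
    rw [Finset.sum_Ico_succ_top han, Finset.sum_Ico_succ_top han]
    have := ih (fun i h1 h2 => h i h1 (by omega)) (fun i h1 h2 => h' i h1 (by omega))
    have := headCross_add_tailCross hp (h n han (by omega)) (h' n han (by omega))
      (h (n + 1) (by omega) le_rfl) (h' (n + 1) (by omega) le_rfl)
    linarith

theorem rayCross_eq_zero_of_nonneg {a b : ℤ × ℤ} (ha : 0 ≤ a.2) (hb : 0 ≤ b.2) :
    rayCross a b = 0 := by
  simp [rayCross, ha, hb]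

/-- A lattice step does not cross the ray if both of its end points lie below the origin, or to its
left on the same line. -/
theorem rayCross_eq_zero_of_neg {a b : ℤ × ℤ} (ha : a.2 < 0 ∨ a.2 = 0 ∧ a.1 < 0)
    (hb : b.2 < 0 ∨ b.2 = 0 ∧ b.1 < 0) (d : Fin 4) (hd : b = a + unitVec d) :
    rayCross a b = 0 := by
  subst hd
  obtain ⟨x, y⟩ := a
  fin_cases d <;> simp [rayCross, unitVec] at * <;> omega

/-- **Hopf's Umlaufsatz** for lattice polygons: a self-avoiding closed lattice path has total turning
`± 1`, that is, `± 4` quarter turns. The path starts at the leftmost of its lowest points. -/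
theorem sum_turn_eq_four (hp : ∀ i, p (i + 1) = p i + unitVec (t i)) {m : ℕ} (hm : 3 ≤ m)
    (hclosed : p m = p 0) (hinj : ∀ i j, i < j → j < m → p i ≠ p j)
    (hmin : ∀ i, 0 < i → i < m → (p 0).2 < (p i).2 ∨ (p 0).2 = (p i).2 ∧ (p 0).1 < (p i).1)
    (htm : t m = t 0) {r : ℕ → ℤ} (ht : ∀ i, IsTurn (t i) (t (i + 1)) (r i)) :
    ∑ i ∈ Finset.range m, r i = 4 ∨ ∑ i ∈ Finset.range m, r i = -4 := by
  rw [sum_turn_eq hp htm ht]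
  obtain ⟨M, rfl⟩ : ∃ M, m = M + 3 := ⟨m - 3, by omega⟩
  -- secants from the starting point do not cross the ray
  have hhead : ∀ j, j < M + 2 → headCross p 0 j = 0 := by
    intro j hj
    apply rayCross_eq_zero_of_nonneg
    · rcases Nat.eq_zero_or_pos j with rfl | h0
      · simp
      · have := hmin j h0 (by omega); simp; omega
    · have := hmin (j + 1) (by omega) (by omega); simp; omega
  have htri : ∀ n, n ≤ M + 1 →
      ∑ i ∈ Finset.range n, (headCross p i (i + 1) + tailCross p i (i + 2)) =
        ∑ i ∈ Finset.range n, tailCross p i (n + 1) := by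
    intro n
    induction n with
    | zero => intro _; simp
    | succ n ih =>
      intro hn
      have hs := sum_tailCross_add_headCross hp (a := 0) (j := n + 1) n (by omega)
        (fun i _ h => hinj i _ (by omega) (by omega)) (fun i _ h => hinj i _ (by omega) (by omega))
      rw [hhead _ (by omega), zero_add, ← Finset.range_eq_Ico] at hs
      rw [Finset.sum_range_succ, ih (by omega), Finset.sum_range_succ, ← hs]
      ring
  -- secants to the end point do not cross the ray either
  have htail : ∀ i, 0 < i → i < M + 2 → tailCross p i (M + 3) = 0 := by
    intro i h0 hi
    unfold tailCross
    have e : p (M + 3) - p i = p (M + 3) - p (i + 1) + unitVec (t i) := by rw [hp i]; abel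
    rw [e, rayCross_add_unitVec_swap, ← e, hclosed,
      rayCross_eq_zero_of_neg (d := t i) ?_ ?_ (hclosed ▸ e), neg_zero]
    · have := hmin (i + 1) (by omega) (by omega); simp; omega
    · have := hmin i (by omega) (by omega); simp; omega
  have hs := sum_tailCross_add_headCross hp (a := 1) (j := M + 2) (M + 1) (by omega)
        (fun i _ h => hinj i _ (by omega) (by omega))
        (fun i _ h => hclosed ▸ (hinj 0 i (by omega) (by omega)).symm)
  rw [Finset.sum_eq_zero (s := Finset.Ico 1 (M + 1)) (f := fun i => tailCross p i (M + 2 + 1))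
    (fun i hi => htail i (by simp at hi; omega) (by simp at hi; omega)), add_zero] at hs
  have htot : ∑ i ∈ Finset.range (M + 3), (headCross p i (i + 1) + tailCross p i (i + 2)) =
      tailCross p 0 (M + 2) + headCross p 1 (M + 2) +
        (headCross p (M + 2) (M + 3) + tailCross p (M + 2) (M + 4)) := by
    rw [Finset.sum_range_succ, Finset.sum_range_succ, htri (M + 1) le_rfl, Finset.range_eq_Ico,
      Finset.sum_eq_sum_Ico_succ_bot (by omega), ← hs, htail (M + 1) (by omega) (by omega)]
    ring
  rw [htot]
  have e₀ : p 1 = p 0 + unitVec (t 0) := hp 0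
  have e₁ : p (M + 2) = p 0 - unitVec (t (M + 2)) := by rw [← hclosed, hp (M + 2)]; abel
  have e₂ : p (M + 4) = p 0 + unitVec (t 0) := by rw [hp (M + 3), hclosed, htm]
  have hne := hinj 1 (M + 2) (by omega) (by omega)
  have h1 := hmin 1 (by omega) (by omega)
  have h2 := hmin (M + 2) (by omega) (by omega)
  simp only [headCross, tailCross, zero_add, Nat.reduceAdd, Nat.add_assoc]
  rw [hclosed, e₂]
  rw [e₀, e₁] at *
  generalize t 0 = d at *
  generalize t (M + 2) = d' at *
  have f₁ : p 0 - unitVec d' - p 0 = - unitVec d' := by abel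
  have f₂ : p 0 - unitVec d' - (p 0 + unitVec d) = - unitVec d' - unitVec d := by abel
  have f₃ : p 0 - (p 0 + unitVec d) = - unitVec d := by abel
  have f₄ : p 0 - (p 0 - unitVec d') = unitVec d' := by abel
  have f₅ : p 0 + unitVec d - (p 0 - unitVec d') = unitVec d + unitVec d' := by abel
  have f₆ : p 0 + unitVec d - p 0 = unitVec d := by abel
  rw [f₁, f₂, f₃, f₄, f₅, f₆]
  have h1' : 0 < (unitVec d).2 ∨ 0 = (unitVec d).2 ∧ 0 < (unitVec d).1 := by
    simp at h1; omega
  have h2' : (unitVec d').2 < 0 ∨ 0 = (unitVec d').2 ∧ (unitVec d').1 < 0 := by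
    simp at h2; omega
  have hne' : unitVec d + unitVec d' ≠ 0 := by
    intro h; apply hne; rw [← sub_eq_zero, ← h]; abel
  clear * - h1' h2' hne'
  revert d d'
  decide

end Secants

/-! ### The turning number of a noncrossing lattice trail -/

section Trails

theorem sum_range_add_period {m : ℕ} {f : ℕ → ℤ} (hf : ∀ i, f (i + m) = f i) (k : ℕ) :
    ∑ i ∈ Finset.range m, f (k + i) = ∑ i ∈ Finset.range m, f i := by
  induction k with
  | zero => simp
  | succ k ih =>
    rw [← ih]
    have h0 := Finset.sum_range_succ (fun i => f (k + i)) m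
    have h1 := Finset.sum_range_succ' (fun i => f (k + i)) m
    have e : ∀ i, f (k + 1 + i) = f (k + (i + 1)) := fun i => by congr 1; omega
    rw [Finset.sum_congr rfl fun i _ => e i]
    rw [hf k] at h0
    rw [add_zero] at h1
    linarith

/-- The direction of the step from the midpoint of an edge in direction `d` to the midpoint of the
following edge of the trail, in the lattice of midpoints turned clockwise by `π / 4`, where `τ` is
`1` if the trail turns left between the two edges and `-1` if it turns right. -/
def medialDir (d : Fin 4) (τ : ℤ) : Fin 4 := if τ = 1 then d else d + 3

/-- The image of a vector under the clockwise rotation by `π / 4`, scaled by `√2`. -/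
def rotate (a : ℤ × ℤ) : ℤ × ℤ := (a.1 + a.2, a.2 - a.1)

/-- The trail makes a left turn (`τ = 1`) or a right turn (`τ = -1`) from direction `d` to direction
`d'`. -/
def IsCorner (d d' : Fin 4) (τ : ℤ) : Prop := τ = 1 ∧ d' = d + 1 ∨ τ = -1 ∧ d' = d + 3

theorem IsCorner.two_mul_unitVec {d d' : Fin 4} {τ : ℤ} (h : IsCorner d d' τ) :
    unitVec (medialDir d τ) + unitVec (medialDir d τ) = rotate (unitVec d + unitVec d') := by
  obtain ⟨rfl, rfl⟩ | ⟨rfl, rfl⟩ := h <;> decide +revert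

/-- The midpoint of a lattice edge determines the edge up to its direction. -/
theorem eq_or_eq_of_midpoint_eq {a b : ℤ × ℤ} {d d' : Fin 4}
    (h : rotate (a + a + unitVec d) = rotate (b + b + unitVec d')) :
    a = b ∧ d = d' ∨ a = b + unitVec d' ∧ d = d' + 2 := by
  obtain ⟨x, y⟩ := a
  obtain ⟨z, w⟩ := b
  fin_cases d <;> fin_cases d' <;> simp [rotate, unitVec, Prod.ext_iff] at h ⊢ <;> omega

/-- The Umlaufsatz for a periodic lattice trail that turns left or right at each step, uses no edge
twice during a period, and may touch itself, but not cross itself: its total turning during a period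
is `± 1` if it is closed, and `0` otherwise. It follows from the Umlaufsatz for the self-avoiding
polygon through the midpoints of the edges of the trail. -/
theorem sum_corner_eq {d : ℕ → Fin 4} {τ : ℕ → ℤ} {V : ℕ → ℤ × ℤ} {m : ℕ} (hm : 0 < m)
    (hd : ∀ i, d (i + m) = d i) (hτ : ∀ i, τ (i + m) = τ i)
    (hcorner : ∀ i, IsCorner (d i) (d (i + 1)) (τ i)) (hV : ∀ i, V (i + 1) = V i + unitVec (d i))
    (hne : ∀ i j, i < j → j < i + m → ¬ (V i = V j ∧ d i = d j))
    (hne' : ∀ i j, ¬ (V i = V j + unitVec (d j) ∧ d i = d j + 2)) :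
    (V m = V 0 → ∑ i ∈ Finset.range m, τ i = 4 ∨ ∑ i ∈ Finset.range m, τ i = -4) ∧
    (V m ≠ V 0 → ∑ i ∈ Finset.range m, τ i = 0) := by
  set t : ℕ → Fin 4 := fun i => medialDir (d i) (τ i) with ht
  set p : ℕ → ℤ × ℤ := fun i => ∑ j ∈ Finset.range i, unitVec (t j) with hpdef
  set r : ℕ → ℤ := fun i => if τ i = τ (i + 1) then τ i else 0 with hrdef
  have hp : ∀ i, p (i + 1) = p i + unitVec (t i) := fun i => Finset.sum_range_succ _ _
  have htper : ∀ i, t (i + m) = t i := fun i => by simp only [ht, hd, hτ]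
  have hrper : ∀ i, r (i + m) = r i := fun i => by
    simp only [hrdef, hτ, show i + m + 1 = i + 1 + m by omega]
  have hturn : ∀ i, IsTurn (t i) (t (i + 1)) (r i) := by
    intro i
    have h1 := hcorner i
    have h2 := hcorner (i + 1)
    simp only [ht, hrdef, IsTurn, medialDir]
    generalize d i = a at *
    generalize d (i + 1) = b at *
    obtain ⟨e1, rfl⟩ | ⟨e1, rfl⟩ := h1 <;> obtain ⟨e2, -⟩ | ⟨e2, -⟩ := h2 <;>
      simp [e1, e2, add_assoc]
  have hsum : ∑ i ∈ Finset.range m, τ i = ∑ i ∈ Finset.range m, r i := by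
    have h2 : ∀ i, 2 * r i = τ i + τ (1 + i) := by
      intro i
      simp only [hrdef, add_comm 1 i]
      rcases hcorner i with ⟨e1, -⟩ | ⟨e1, -⟩ <;> rcases hcorner (i + 1) with ⟨e2, -⟩ | ⟨e2, -⟩ <;>
        simp [e1, e2]
    have h3 : 2 * ∑ i ∈ Finset.range m, r i = 2 * ∑ i ∈ Finset.range m, τ i := by
      rw [Finset.mul_sum, Finset.sum_congr rfl fun i _ => h2 i, Finset.sum_add_distrib,
        sum_range_add_period hτ]
      ring
    linarith
  have hmid : ∀ i, p i + p i = rotate (V i + V i + unitVec (d i)) -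
      rotate (V 0 + V 0 + unitVec (d 0)) := by
    intro i
    induction i with
    | zero => simp [hpdef]
    | succ i ih =>
      have e1 := (hcorner i).two_mul_unitVec
      have e2 : p (i + 1) + p (i + 1) =
          (p i + p i) + (unitVec (t i) + unitVec (t i)) := by rw [hp]; abel
      rw [e2, ih, show unitVec (t i) + unitVec (t i) = _ from e1, hV]
      ext <;> simp [rotate] <;> ring
  have hVper : ∀ i, V (i + m) = V i + (V m - V 0) := by
    intro i
    induction i with
    | zero => simp
    | succ i ih => rw [show i + 1 + m = i + m + 1 by omega, hV, ih, hd, hV]; abel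
  have hpper : ∀ i, p (i + m) = p i + rotate (V m - V 0) := by
    intro i
    have h1 := hmid i
    have h2 := hmid (i + m)
    rw [hVper, hd] at h2
    simp [rotate, Prod.ext_iff] at h1 h2 ⊢
    omega
  have hinj : ∀ i j, i < j → j < i + m → p i ≠ p j := by
    intro i j hij hj h
    have h1 := hmid i
    rw [h, hmid j, sub_left_inj] at h1
    rcases eq_or_eq_of_midpoint_eq h1 with h2 | h2
    · exact hne i j hij hj ⟨h2.1.symm, h2.2.symm⟩
    · exact hne' j i h2
  have hm1 : m ≠ 1 := by
    rintro rfl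
    have h1 := hcorner 0
    rw [hd 0] at h1
    generalize d 0 = a at h1
    obtain ⟨-, h⟩ | ⟨-, h⟩ := h1 <;> revert a <;> decide
  rw [hsum]
  constructor
  · intro h0
    have hm2 : m ≠ 2 := by
      rintro rfl
      have h1 := hcorner 0
      rw [hV 1, hV 0, add_assoc, add_eq_left] at h0
      generalize d (0 + 1) = b at *
      generalize d 0 = a at *
      obtain ⟨-, rfl⟩ | ⟨-, rfl⟩ := h1 <;> clear * - h0 <;> revert a <;> decide
    rw [h0, sub_self] at hpper
    have hpper' : ∀ i, p (i + m) = p i := fun i => by rw [hpper]; simp [rotate]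
    obtain ⟨k, hk, hkmin⟩ := Finset.exists_min_image (Finset.range m)
      (fun i => toLex ((p i).2, (p i).1)) ⟨0, by simp; omega⟩
    simp only [Finset.mem_range] at hk hkmin
    have hkmin' : ∀ i, 0 < i → i < m →
        (p k).2 < (p (k + i)).2 ∨ (p k).2 = (p (k + i)).2 ∧ (p k).1 < (p (k + i)).1 := by
      intro i hi hi'
      have hne : p k ≠ p (k + i) := hinj k (k + i) (by omega) (by omega)
      have hle : toLex ((p k).2, (p k).1) ≤ toLex ((p (k + i)).2, (p (k + i)).1) := by
        rcases lt_or_ge (k + i) m with h | h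
        · exact hkmin _ h
        · obtain ⟨j, hj⟩ : ∃ j, k + i = j + m := ⟨k + i - m, by omega⟩
          rw [hj, hpper']
          exact hkmin _ (by omega)
      rw [Prod.Lex.toLex_le_toLex] at hle
      rcases hle with h | ⟨h, h'⟩
      · exact Or.inl h
      · refine Or.inr ⟨h, lt_of_le_of_ne h' fun h'' => hne (Prod.ext h'' h)⟩
    rw [← sum_range_add_period hrper k]
    exact sum_turn_eq_four (p := fun i => p (k + i)) (t := fun i => t (k + i)) (fun i => hp _) (by omega)
      (hpper' k) (fun i j hij hj => hinj _ _ (by omega) (by omega)) hkmin' (htper k)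
      (fun i => hturn _)
  · intro h0
    refine sum_turn_eq_zero hp (by omega) (D := rotate (V m - V 0)) ?_ hpper hinj
      (by simpa using htper 0) hturn
    intro h
    apply h0
    simp [rotate, Prod.ext_iff] at h ⊢
    omega

end Trails

/-! ### The loops of a loop configuration -/

section Loops

variable {N₁ N₂ : ℕ}

theorem move_move_add_two (v : ZMod (2 * N₁) × ZMod (2 * N₂)) (d : Fin 4) :
    move (move v d) (d + 2) = v := by
  obtain ⟨x, y⟩ := v
  fin_cases d <;> simp [move, unitVec]

theorem DEdge.rev_rev (x : DEdge N₁ N₂) : x.rev.rev = x := by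
  obtain ⟨v, d⟩ := x
  simp only [DEdge.rev, DEdge.head, move_move_add_two, Prod.mk.injEq, true_and]
  rw [add_assoc]; exact add_zero d

theorem DEdge.rev_involutive : Function.Involutive (DEdge.rev : DEdge N₁ N₂ → DEdge N₁ N₂) :=
  DEdge.rev_rev

theorem DEdge.rev_injective : Function.Injective (DEdge.rev : DEdge N₁ N₂ → DEdge N₁ N₂) :=
  DEdge.rev_involutive.injective

theorem DEdge.head_rev (x : DEdge N₁ N₂) : x.rev.head = x.1 := move_move_add_two x.1 x.2

theorem mem_reverse {H : Finset (DEdge N₁ N₂)} {x : DEdge N₁ N₂} : x ∈ reverse H ↔ x.rev ∈ H := by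
  simp only [reverse, Finset.mem_image]
  constructor
  · rintro ⟨y, hy, rfl⟩; rwa [DEdge.rev_rev]
  · intro h; exact ⟨_, h, DEdge.rev_rev x⟩

theorem reverse_reverse (H : Finset (DEdge N₁ N₂)) : reverse (reverse H) = H := by
  ext x; rw [mem_reverse, mem_reverse, DEdge.rev_rev]

theorem partner_partner (b : Bool) (d : Fin 4) : partner b (partner b d) = d := by
  revert b d; decide

theorem partner_corner (b : Bool) (d : Fin 4) :
    partner b (d + 2) = d + 1 ∨ partner b (d + 2) = d + 3 := by
  revert b d; decide

/-- Reversing orientation turns the successor map of a loop into its inverse. -/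
theorem next_rev_next (L : LoopConfig N₁ N₂) (x : DEdge N₁ N₂) :
    next L (next L x).rev = x.rev := by
  have h : (next L x).rev.head = x.head := DEdge.head_rev _
  have h2 : (next L x).rev.2 + 2 = (next L x).2 := by
    simp only [DEdge.rev]; rw [add_assoc]; exact add_zero _
  rw [next, h, h2]
  simp only [next, partner_partner]
  rfl

theorem next_injective (L : LoopConfig N₁ N₂) : Function.Injective (next L) := fun x y h =>
  DEdge.rev_injective (by rw [← next_rev_next L x, ← next_rev_next L y, h])

/-- The corner of the loop through `x` at the head of `x`: `1` for a left turn, `-1` for a right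
turn. -/
def turn (L : LoopConfig N₁ N₂) (x : DEdge N₁ N₂) : ℤ := if (next L x).2 = x.2 + 1 then 1 else -1

theorem isCorner_next (L : LoopConfig N₁ N₂) (x : DEdge N₁ N₂) :
    IsCorner x.2 (next L x).2 (turn L x) := by
  unfold turn IsCorner
  split_ifs with h
  · exact Or.inl ⟨rfl, h⟩
  · exact Or.inr ⟨rfl, (partner_corner _ _).resolve_left h⟩

theorem turn_rev_next (L : LoopConfig N₁ N₂) (x : DEdge N₁ N₂) :
    turn L (next L x).rev = -turn L x := by
  have h : (next L (next L x).rev).2 = x.2 + 2 := by rw [next_rev_next]; rfl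
  have h' : (next L x).rev.2 = (next L x).2 + 2 := rfl
  have h1 := isCorner_next L x
  simp only [turn, h, h']
  generalize (next L x).2 = d at *
  obtain ⟨-, rfl⟩ | ⟨-, rfl⟩ := h1 <;> clear * - <;> generalize x.2 = d <;> revert d <;> decide

theorem winding_eq_sum (L : LoopConfig N₁ N₂) (o : Finset (DEdge N₁ N₂)) :
    winding L o = ((∑ x ∈ o, turn L x : ℤ) : ℝ) / 4 := by
  have h1 : ∀ x, turn L x = (if (next L x).2 = x.2 + 1 then 1 else 0) -
      (if (next L x).2 = x.2 + 3 then 1 else 0) := by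
    intro x
    have := isCorner_next L x
    unfold turn
    generalize (next L x).2 = d at *
    obtain ⟨-, rfl⟩ | ⟨-, rfl⟩ := this <;> clear * - <;> generalize x.2 = d <;> revert d <;> decide
  rw [winding, Finset.sum_congr rfl fun x _ => h1 x, Finset.sum_sub_distrib, Finset.sum_boole,
    Finset.sum_boole]
  push_cast
  rfl

variable [NeZero N₁] [NeZero N₂]

/-- The number of edges of the oriented loop through `x`. -/
noncomputable abbrev period (L : LoopConfig N₁ N₂) (x : DEdge N₁ N₂) : ℕ := Function.minimalPeriod (next L) x

theorem period_pos (L : LoopConfig N₁ N₂) (x : DEdge N₁ N₂) : 0 < period L x :=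
  Function.minimalPeriod_pos_of_mem_periodicPts ((next_injective L).mem_periodicPts x)

theorem mem_orientedLoop {L : LoopConfig N₁ N₂} {x y : DEdge N₁ N₂} :
    y ∈ orientedLoop L x ↔ ∃ m : ℕ, (next L)^[m] x = y := by
  simp [orientedLoop]

theorem self_mem_orientedLoop (L : LoopConfig N₁ N₂) (x : DEdge N₁ N₂) : x ∈ orientedLoop L x :=
  mem_orientedLoop.2 ⟨0, rfl⟩

theorem sum_orientedLoop {M : Type*} [AddCommMonoid M] (L : LoopConfig N₁ N₂) (x : DEdge N₁ N₂)
    (f : DEdge N₁ N₂ → M) :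
    ∑ y ∈ orientedLoop L x, f y = ∑ i ∈ Finset.range (period L x), f ((next L)^[i] x) := by
  symm
  refine Finset.sum_bij (fun i _ => (next L)^[i] x) (fun i _ => mem_orientedLoop.2 ⟨i, rfl⟩) ?_ ?_
    (fun _ _ => rfl)
  · intro i hi j hj h
    exact Function.iterate_injOn_Iio_minimalPeriod (Finset.mem_range.1 hi) (Finset.mem_range.1 hj) h
  · intro y hy
    obtain ⟨m, rfl⟩ := mem_orientedLoop.1 hy
    exact ⟨m % period L x, Finset.mem_range.2 (Nat.mod_lt _ (period_pos L x)),
      Function.iterate_mod_minimalPeriod_eq⟩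

theorem orientedLoop_eq_of_mem {L : LoopConfig N₁ N₂} {x y : DEdge N₁ N₂}
    (h : y ∈ orientedLoop L x) : orientedLoop L y = orientedLoop L x := by
  obtain ⟨m, rfl⟩ := mem_orientedLoop.1 h
  ext z
  rw [mem_orientedLoop, mem_orientedLoop]
  constructor
  · rintro ⟨k, rfl⟩
    exact ⟨k + m, Function.iterate_add_apply _ _ _ _⟩
  · rintro ⟨k, rfl⟩
    have hper : (next L)^[m * period L x] x = x :=
      (Function.isPeriodicPt_minimalPeriod (next L) x).const_mul m
    have hle : m ≤ m * period L x := Nat.le_mul_of_pos_right _ (period_pos L x)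
    refine ⟨k + (m * period L x - m), ?_⟩
    rw [← Function.iterate_add_apply, show k + (m * period L x - m) + m = k + m * period L x by
      omega, Function.iterate_add_apply, hper]

theorem orientedLoop_next (L : LoopConfig N₁ N₂) (x : DEdge N₁ N₂) :
    orientedLoop L (next L x) = orientedLoop L x :=
  orientedLoop_eq_of_mem (mem_orientedLoop.2 ⟨1, rfl⟩)

theorem orientedLoop_rev_next (L : LoopConfig N₁ N₂) (x : DEdge N₁ N₂) :
    orientedLoop L (next L x).rev = orientedLoop L x.rev := by
  rw [← orientedLoop_next L (next L x).rev, next_rev_next]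

theorem orientedLoop_eq_iff {L : LoopConfig N₁ N₂} {x y : DEdge N₁ N₂} :
    orientedLoop L x = orientedLoop L y ↔ x ∈ orientedLoop L y :=
  ⟨fun h => h ▸ self_mem_orientedLoop L x, orientedLoop_eq_of_mem⟩

theorem sum_orientedLoop_next {M : Type*} [AddCommMonoid M] (L : LoopConfig N₁ N₂)
    (x : DEdge N₁ N₂) (f : DEdge N₁ N₂ → M) :
    ∑ y ∈ orientedLoop L x, f (next L y) = ∑ y ∈ orientedLoop L x, f y := by
  refine Finset.sum_nbij (next L) ?_ (next_injective L).injOn ?_ (fun _ _ => rfl)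
  · intro y hy
    rwa [← orientedLoop_eq_iff, orientedLoop_next, orientedLoop_eq_iff]
  · refine Finset.surjOn_of_injOn_of_card_le _ ?_ (next_injective L).injOn le_rfl
    intro y hy
    rw [Finset.mem_coe] at *
    rwa [← orientedLoop_eq_iff, orientedLoop_next, orientedLoop_eq_iff]

theorem sum_turn_rev (L : LoopConfig N₁ N₂) (x : DEdge N₁ N₂) :
    ∑ y ∈ orientedLoop L x, turn L y.rev = -∑ y ∈ orientedLoop L x, turn L y := by
  rw [← sum_orientedLoop_next L x (fun y => turn L y.rev), ← Finset.sum_neg_distrib]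
  exact Finset.sum_congr rfl fun y _ => turn_rev_next L y

end Loops

/-! ### Loops with black faces on their left -/

section Orientation

variable {N₁ N₂ : ℕ}

/-- The face to the left of a directed edge. -/
def leftFace (x : DEdge N₁ N₂) : Face N₁ N₂ :=
  (![(x.1.1, x.1.2), (x.1.1 - 1, x.1.2), (x.1.1 - 1, x.1.2 - 1), (x.1.1, x.1.2 - 1)] :
    Fin 4 → Face N₁ N₂) x.2

theorem leftFace_rev (x : DEdge N₁ N₂) : leftFace x.rev = move (leftFace x) (x.2 + 3) := by
  obtain ⟨⟨a, b⟩, d⟩ := x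
  fin_cases d <;> simp [leftFace, DEdge.rev, DEdge.head, move, unitVec] <;> ring_nf
  trivial

theorem leftFace_next_of_left {L : LoopConfig N₁ N₂} {x : DEdge N₁ N₂}
    (h : (next L x).2 = x.2 + 1) : leftFace (next L x) = leftFace x := by
  have e : next L x = (x.head, x.2 + 1) := Prod.ext rfl h
  rw [e]
  obtain ⟨⟨a, b⟩, d⟩ := x
  fin_cases d <;> simp [leftFace, DEdge.head, move, unitVec, sub_eq_add_neg]

theorem leftFace_next_of_right {L : LoopConfig N₁ N₂} {x : DEdge N₁ N₂}
    (h : (next L x).2 = x.2 + 3) :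
    leftFace (next L x) = move (move (leftFace x) x.2) (x.2 + 3) := by
  have e : next L x = (x.head, x.2 + 3) := Prod.ext rfl h
  rw [e]
  obtain ⟨⟨a, b⟩, d⟩ := x
  fin_cases d <;> simp [leftFace, DEdge.head, move, unitVec] <;> ring_nf
  trivial

variable {black : Set (Face N₁ N₂)}

theorem leftFace_rev_mem (hblack : IsChessboard black) (x : DEdge N₁ N₂) :
    leftFace x.rev ∈ black ↔ leftFace x ∉ black := by
  rw [leftFace_rev, hblack]

/-- A loop keeps the same colour on its left: it walks around the face to its left or to its right
at each corner. -/
theorem leftFace_next_mem (hblack : IsChessboard black) (L : LoopConfig N₁ N₂) (x : DEdge N₁ N₂) :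
    leftFace (next L x) ∈ black ↔ leftFace x ∈ black := by
  rcases partner_corner (L x.head) x.2 with h | h
  · rw [leftFace_next_of_left h]
  · rw [leftFace_next_of_right h, hblack, hblack, not_not]

theorem leftFace_iterate_mem (hblack : IsChessboard black) (L : LoopConfig N₁ N₂) (x : DEdge N₁ N₂)
    (m : ℕ) : leftFace ((next L)^[m] x) ∈ black ↔ leftFace x ∈ black := by
  induction m with
  | zero => rfl
  | succ m ih => rw [Function.iterate_succ_apply', leftFace_next_mem hblack, ih]

theorem iterate_next_rev (L : LoopConfig N₁ N₂) (x : DEdge N₁ N₂) (m : ℕ) :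
    (next L)^[m] ((next L)^[m] x).rev = x.rev := by
  induction m with
  | zero => rfl
  | succ m ih =>
    rw [Function.iterate_succ_apply, Function.iterate_succ_apply', next_rev_next, ih]

theorem displacement_reverse (o : Finset (DEdge N₁ N₂)) :
    displacement (reverse o) = -displacement o := by
  classical
  rw [displacement, reverse, Finset.sum_image DEdge.rev_injective.injOn, displacement,
    ← Finset.sum_neg_distrib]
  refine Finset.sum_congr rfl fun x _ => ?_
  simp only [DEdge.rev]
  generalize x.2 = d
  revert d; decide

variable [NeZero N₁] [NeZero N₂]

theorem leftFace_mem_of_mem (hblack : IsChessboard black) {L : LoopConfig N₁ N₂}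
    {x y : DEdge N₁ N₂} (h : y ∈ orientedLoop L x) : leftFace y ∈ black ↔ leftFace x ∈ black := by
  obtain ⟨m, rfl⟩ := mem_orientedLoop.1 h
  exact leftFace_iterate_mem hblack L x m

theorem reverse_orientedLoop (L : LoopConfig N₁ N₂) (x : DEdge N₁ N₂) :
    reverse (orientedLoop L x) = orientedLoop L x.rev := by
  have key : ∀ x y : DEdge N₁ N₂, y.rev ∈ orientedLoop L x → y ∈ orientedLoop L x.rev := by
    intro x y h
    obtain ⟨m, hm⟩ := mem_orientedLoop.1 h
    rw [← orientedLoop_eq_iff, eq_comm, orientedLoop_eq_iff]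
    refine mem_orientedLoop.2 ⟨m, ?_⟩
    rw [← iterate_next_rev L x m, hm, DEdge.rev_rev]
  ext y
  rw [mem_reverse]
  refine ⟨key x y, fun h => ?_⟩
  have := key x.rev y.rev (by rwa [DEdge.rev_rev])
  rwa [DEdge.rev_rev] at this

/-- The Umlaufsatz for the loops of a loop configuration on the torus. -/
theorem sum_turn_orientedLoop (hblack : IsChessboard black) (L : LoopConfig N₁ N₂)
    (x : DEdge N₁ N₂) :
    (displacement (orientedLoop L x) = 0 →
      ∑ y ∈ orientedLoop L x, turn L y = 4 ∨ ∑ y ∈ orientedLoop L x, turn L y = -4) ∧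
    (displacement (orientedLoop L x) ≠ 0 → ∑ y ∈ orientedLoop L x, turn L y = 0) := by
  have hx : ∀ i, (next L)^[i + 1] x = next L ((next L)^[i] x) :=
    fun i => Function.iterate_succ_apply' _ _ _
  have hper : ∀ i, (next L)^[i + period L x] x = (next L)^[i] x := fun i => by
    rw [Function.iterate_add_apply, Function.iterate_minimalPeriod]
  set V : ℕ → ℤ × ℤ := fun i => ∑ j ∈ Finset.range i, unitVec ((next L)^[j] x).2 with hVdef
  have hV : ∀ i, V (i + 1) = V i + unitVec ((next L)^[i] x).2 := fun i => Finset.sum_range_succ _ _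
  -- `V` is a lift of the loop to the plane
  have hcov : ∀ i, ((next L)^[i] x).1 =
      (x.1.1 + ((V i).1 : ZMod (2 * N₁)), x.1.2 + ((V i).2 : ZMod (2 * N₂))) := by
    intro i
    induction i with
    | zero => simp [hVdef]
    | succ i ih =>
      have e : ((next L)^[i + 1] x).1 = move ((next L)^[i] x).1 ((next L)^[i] x).2 := by
        rw [hx]; rfl
      rw [e, hV, move, ih]
      ext <;> simp [add_assoc]
  have key := sum_corner_eq (d := fun i => ((next L)^[i] x).2) (τ := fun i => turn L ((next L)^[i] x))
    (V := V) (period_pos L x) (fun i => by rw [hper]) (fun i => by rw [hper])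
    (fun i => by rw [hx]; exact isCorner_next L _) hV ?_ ?_
  · rw [sum_orientedLoop, displacement, sum_orientedLoop]
    simpa [hVdef] using key
  · rintro i j hij hj ⟨h1, h2⟩
    have e : (next L)^[j] x = (next L)^[i] x := by
      refine Prod.ext ?_ h2.symm
      rw [hcov, hcov, h1]
    obtain ⟨k, rfl⟩ : ∃ k, j = i + k := ⟨j - i, by omega⟩
    rw [Function.iterate_add_apply] at e
    have := Function.IsPeriodicPt.minimalPeriod_le (by omega)
      (show Function.IsPeriodicPt (next L) k x from (next_injective L).iterate i e)
    change period L x ≤ k at this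
    omega
  · rintro i j ⟨h1, h2⟩
    have e : (next L)^[i] x = ((next L)^[j] x).rev := by
      refine Prod.ext ?_ h2
      change _ = move ((next L)^[j] x).1 ((next L)^[j] x).2
      rw [hcov, move, hcov, h1]
      ext <;> simp [add_assoc]
    have h3 := leftFace_iterate_mem hblack L x i
    rw [e, leftFace_rev_mem hblack, leftFace_iterate_mem hblack] at h3
    tauto

open Classical in
/-- The oriented loops of `L` that have black faces on their left. Each loop has exactly one such
oriented version. -/
noncomputable def blackLeftLoops (black : Set (Face N₁ N₂)) (L : LoopConfig N₁ N₂) :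
    Finset (Finset (DEdge N₁ N₂)) :=
  (Finset.univ.filter fun x : DEdge N₁ N₂ => leftFace x ∈ black).image (orientedLoop L)

theorem mem_blackLeftLoops {L : LoopConfig N₁ N₂} {o : Finset (DEdge N₁ N₂)} :
    o ∈ blackLeftLoops black L ↔ ∃ x, leftFace x ∈ black ∧ orientedLoop L x = o := by
  simp [blackLeftLoops]

/-- The loops of `L` are indexed by their oriented versions with black on the left. -/
theorem prod_loops (hblack : IsChessboard black) (L : LoopConfig N₁ N₂)
    (f : Sym2 (Finset (DEdge N₁ N₂)) → ℂ) :
    ∏ l ∈ loops L, f l = ∏ o ∈ blackLeftLoops black L, f s(o, reverse o) := by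
  classical
  symm
  refine Finset.prod_bij (fun o _ => s(o, reverse o)) ?_ ?_ ?_ (fun _ _ => rfl)
  · intro o ho
    obtain ⟨x, -, rfl⟩ := mem_blackLeftLoops.1 ho
    simp only [loops, Finset.mem_image, Finset.mem_univ, true_and]
    exact ⟨x, rfl⟩
  · intro o ho o' ho' h
    obtain ⟨x, hx, rfl⟩ := mem_blackLeftLoops.1 ho
    obtain ⟨y, hy, rfl⟩ := mem_blackLeftLoops.1 ho'
    rw [Sym2.eq_iff] at h
    rcases h with h | h
    · exact h.1
    · rw [reverse_orientedLoop, orientedLoop_eq_iff] at h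
      have := leftFace_mem_of_mem hblack h.1
      rw [leftFace_rev_mem hblack] at this
      tauto
  · intro l hl
    simp only [loops, Finset.mem_image, Finset.mem_univ, true_and] at hl
    obtain ⟨x, rfl⟩ := hl
    by_cases hx : leftFace x ∈ black
    · exact ⟨_, mem_blackLeftLoops.2 ⟨x, hx, rfl⟩, rfl⟩
    · refine ⟨_, mem_blackLeftLoops.2 ⟨x.rev, (leftFace_rev_mem hblack x).2 hx, rfl⟩, ?_⟩
      rw [← reverse_orientedLoop, reverse_reverse, Sym2.eq_swap]

end Orientation

/-! ### Expanding over orientations of loops -/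

section Coherent

variable {N₁ N₂ : ℕ} {black : Set (Face N₁ N₂)}

/-- `α` contains exactly one of the two directed versions of each edge. -/
def IsOrientation (α : Finset (DEdge N₁ N₂)) : Prop :=
  ∀ x : DEdge N₁ N₂, Xor (x ∈ α) (x.rev ∈ α)

/-- `α` is a union of oriented loops of `L`. -/
def IsCoherent (L : LoopConfig N₁ N₂) (α : Finset (DEdge N₁ N₂)) : Prop :=
  ∀ x : DEdge N₁ N₂, next L x ∈ α ↔ x ∈ α

theorem IsOrientation.rev_mem_iff {α : Finset (DEdge N₁ N₂)} (h : IsOrientation α)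
    (x : DEdge N₁ N₂) : x.rev ∈ α ↔ x ∉ α := by
  rcases h x with h | h <;> tauto

variable [NeZero N₁] [NeZero N₂]

theorem IsCoherent.mem_of_mem {L : LoopConfig N₁ N₂} {α : Finset (DEdge N₁ N₂)}
    (h : IsCoherent L α) {x y : DEdge N₁ N₂} (hy : y ∈ orientedLoop L x) : y ∈ α ↔ x ∈ α := by
  obtain ⟨m, rfl⟩ := mem_orientedLoop.1 hy
  induction m with
  | zero => rfl
  | succ m ih => rw [Function.iterate_succ_apply', h, ih (mem_orientedLoop.2 ⟨m, rfl⟩)]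

open Classical in
/-- Each edge has exactly one directed version with a black face on its left. -/
theorem IsOrientation.prod_eq (hblack : IsChessboard black) {α : Finset (DEdge N₁ N₂)}
    (h : IsOrientation α) (G : DEdge N₁ N₂ → ℂ) :
    ∏ x ∈ α, G x = ∏ x ∈ Finset.univ.filter (fun x : DEdge N₁ N₂ => leftFace x ∈ black),
      if x ∈ α then G x else G x.rev := by
  rw [Finset.prod_ite, ← Finset.prod_filter_mul_prod_filter_not α (fun x => leftFace x ∈ black)]
  congr 1
  · refine Finset.prod_congr ?_ fun _ _ => rfl
    ext x; simp [and_comm]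
  · refine Finset.prod_bij' (fun x _ => x.rev) (fun x _ => x.rev) ?_ ?_
      (fun x _ => DEdge.rev_rev x) (fun x _ => DEdge.rev_rev x) (fun x _ => by rw [DEdge.rev_rev])
    · intro x hx
      simp only [Finset.mem_filter, Finset.mem_univ, true_and, leftFace_rev_mem hblack,
        h.rev_mem_iff] at hx ⊢
      tauto
    · intro x hx
      simp only [Finset.mem_filter, Finset.mem_univ, true_and, leftFace_rev_mem hblack,
        h.rev_mem_iff] at hx ⊢
      tauto

open Classical in
/-- The union of the loops in `S`, with black on their left, and of the other loops with the
opposite orientation. -/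
noncomputable def orient (black : Set (Face N₁ N₂)) (L : LoopConfig N₁ N₂)
    (S : Finset (Finset (DEdge N₁ N₂))) : Finset (DEdge N₁ N₂) :=
  Finset.univ.filter fun x =>
    if leftFace x ∈ black then orientedLoop L x ∈ S else orientedLoop L x.rev ∉ S

theorem mem_orient_of_mem {L : LoopConfig N₁ N₂} {S : Finset (Finset (DEdge N₁ N₂))}
    {x : DEdge N₁ N₂} (hx : leftFace x ∈ black) :
    x ∈ orient black L S ↔ orientedLoop L x ∈ S := by
  simp [orient, hx]

theorem mem_orient_of_notMem {L : LoopConfig N₁ N₂} {S : Finset (Finset (DEdge N₁ N₂))}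
    {x : DEdge N₁ N₂} (hx : leftFace x ∉ black) :
    x ∈ orient black L S ↔ orientedLoop L x.rev ∉ S := by
  simp [orient, hx]

theorem isOrientation_orient (hblack : IsChessboard black) (L : LoopConfig N₁ N₂)
    (S : Finset (Finset (DEdge N₁ N₂))) : IsOrientation (orient black L S) := by
  intro x
  by_cases hx : leftFace x ∈ black
  · have hx' : leftFace x.rev ∉ black := by rw [leftFace_rev_mem hblack]; tauto
    rw [mem_orient_of_mem hx, mem_orient_of_notMem hx', DEdge.rev_rev]
    unfold Xor
    tauto
  · rw [mem_orient_of_notMem hx, mem_orient_of_mem ((leftFace_rev_mem hblack x).2 hx)]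
    unfold Xor
    tauto

theorem isCoherent_orient (hblack : IsChessboard black) (L : LoopConfig N₁ N₂)
    (S : Finset (Finset (DEdge N₁ N₂))) : IsCoherent L (orient black L S) := by
  intro x
  by_cases hx : leftFace x ∈ black
  · rw [mem_orient_of_mem hx, mem_orient_of_mem ((leftFace_next_mem hblack L x).2 hx),
      orientedLoop_next]
  · rw [mem_orient_of_notMem hx, mem_orient_of_notMem (by rwa [leftFace_next_mem hblack]),
      orientedLoop_rev_next]

open Classical in
/-- A product over loops of sums over the two orientations is a sum over the orientations of all
edges that are coherent along the loops. -/
theorem prod_add_eq_sum_coherent (hblack : IsChessboard black) (L : LoopConfig N₁ N₂)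
    (G : DEdge N₁ N₂ → ℂ) :
    ∏ o ∈ blackLeftLoops black L, (∏ x ∈ o, G x + ∏ x ∈ o, G x.rev) =
      ∑ α ∈ Finset.univ.filter (fun α : Finset (DEdge N₁ N₂) => IsOrientation α ∧ IsCoherent L α),
        ∏ x ∈ α, G x := by
  rw [Finset.prod_add]
  refine Finset.sum_bij' (fun S _ => orient black L S)
    (fun α _ => (blackLeftLoops black L).filter fun o => o ⊆ α) ?_ ?_ ?_ ?_ ?_
  · intro S _
    simp [isOrientation_orient hblack, isCoherent_orient hblack]
  · intro α _
    simp
  · intro S hS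
    rw [Finset.mem_powerset] at hS
    ext o
    rw [Finset.mem_filter]
    constructor
    · rintro ⟨ho, ho'⟩
      obtain ⟨x, hx, rfl⟩ := mem_blackLeftLoops.1 ho
      exact (mem_orient_of_mem hx).1 (ho' (self_mem_orientedLoop L x))
    · intro ho
      refine ⟨hS ho, fun y hy => ?_⟩
      obtain ⟨x, hx, rfl⟩ := mem_blackLeftLoops.1 (hS ho)
      rw [mem_orient_of_mem ((leftFace_mem_of_mem hblack hy).2 hx), orientedLoop_eq_of_mem hy]
      exact ho
  · intro α hα
    simp only [Finset.mem_filter, Finset.mem_univ, true_and] at hα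
    have key : ∀ x, leftFace x ∈ black →
        (x ∈ orient black L ((blackLeftLoops black L).filter fun o => o ⊆ α) ↔ x ∈ α) := by
      intro x hx
      rw [mem_orient_of_mem hx, Finset.mem_filter]
      constructor
      · rintro ⟨-, h⟩
        exact h (self_mem_orientedLoop L x)
      · intro h
        exact ⟨mem_blackLeftLoops.2 ⟨x, hx, rfl⟩, fun y hy => (hα.2.mem_of_mem hy).2 h⟩
    ext x
    by_cases hx : leftFace x ∈ black
    · exact key x hx
    · have h1 := key x.rev ((leftFace_rev_mem hblack x).2 hx)
      rw [hα.1.rev_mem_iff, (isOrientation_orient hblack L _).rev_mem_iff, not_iff_not] at h1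
      exact h1
  · intro S hS
    rw [Finset.mem_powerset] at hS
    rw [(isOrientation_orient hblack L S).prod_eq hblack,
      ← Finset.prod_fiberwise_of_maps_to (t := blackLeftLoops black L) (g := orientedLoop L)
        (fun x hx => mem_blackLeftLoops.2 ⟨x, (Finset.mem_filter.1 hx).2, rfl⟩)]
    have hfib : ∀ o ∈ blackLeftLoops black L,
        ∏ x ∈ (Finset.univ.filter fun x : DEdge N₁ N₂ => leftFace x ∈ black).filter
          (fun x => orientedLoop L x = o),
          (if x ∈ orient black L S then G x else G x.rev) =
        if o ∈ S then ∏ x ∈ o, G x else ∏ x ∈ o, G x.rev := by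
      intro o ho
      obtain ⟨y, hy, rfl⟩ := mem_blackLeftLoops.1 ho
      have e : (Finset.univ.filter fun x : DEdge N₁ N₂ => leftFace x ∈ black).filter
          (fun x => orientedLoop L x = orientedLoop L y) = orientedLoop L y := by
        ext x
        simp only [Finset.mem_filter, Finset.mem_univ, true_and, orientedLoop_eq_iff]
        exact ⟨fun h => h.2, fun h => ⟨(leftFace_mem_of_mem hblack h).2 hy, h⟩⟩
      rw [e]
      have hmem : ∀ x ∈ orientedLoop L y, (x ∈ orient black L S ↔ orientedLoop L y ∈ S) := by
        intro x hx
        rw [mem_orient_of_mem ((leftFace_mem_of_mem hblack hx).2 hy), orientedLoop_eq_of_mem hx]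
      split_ifs with h
      · exact Finset.prod_congr rfl fun x hx => if_pos ((hmem x hx).2 h)
      · exact Finset.prod_congr rfl fun x hx => if_neg (mt (hmem x hx).1 h)
    rw [Finset.prod_congr rfl hfib, Finset.prod_ite]
    congr 1
    · refine Finset.prod_congr ?_ fun _ _ => rfl
      ext o
      rw [Finset.mem_filter]
      exact ⟨fun h => ⟨hS h, h⟩, fun h => h.2⟩
    · refine Finset.prod_congr ?_ fun _ _ => rfl
      ext o
      rw [Finset.mem_filter, Finset.mem_sdiff]

end Coherent

/-! ### Local weights -/

section Weights

variable {N₁ N₂ : ℕ}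

/-- The pairing `b` of half-edges at a vertex connects incoming to outgoing half-edges only, where
`η d` says whether the half-edge in direction `d` is outgoing. -/
def IsLocallyCoherent (η : Fin 4 → Bool) (b : Bool) : Prop := ∀ d, η (partner b d) = !η d

instance (η : Fin 4 → Bool) (b : Bool) : Decidable (IsLocallyCoherent η b) :=
  inferInstanceAs (Decidable (∀ d, η (partner b d) = !η d))

/-- The number of left turns minus the number of right turns at a vertex, where a path that arrives
through the half-edge in direction `d` leaves through `partner b d`. -/
def localTurn (η : Fin 4 → Bool) (b : Bool) : ℤ :=
  ∑ d, if η d then 0 else if partner b d = d + 3 then 1 else -1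

/-- Only if two arrows point towards a vertex can its half-edges be connected coherently: in one way
if the arrows do not alternate, which leads to a left and a right turn, and in two ways otherwise,
one of which leads to two left turns and the other to two right turns. -/
theorem localTurn_cases (η : Fin 4 → Bool) :
    ((Finset.univ.filter fun d => η d = false).card = 2 ∧ (∀ d, η d = !η (d + 1)) ∧
      (∀ b, IsLocallyCoherent η b) ∧
      (localTurn η true = 2 ∧ localTurn η false = -2 ∨
        localTurn η true = -2 ∧ localTurn η false = 2)) ∨
    ((Finset.univ.filter fun d => η d = false).card = 2 ∧ ¬ (∀ d, η d = !η (d + 1)) ∧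
      ∃ b, IsLocallyCoherent η b ∧ ¬ IsLocallyCoherent η (!b) ∧ localTurn η b = 0) ∨
    ((Finset.univ.filter fun d => η d = false).card ≠ 2 ∧ ∀ b, ¬ IsLocallyCoherent η b) := by
  revert η; decide

/-- The winding phases of the coherent pairings at a vertex add up to its six-vertex weight, as
`exp (i lam / 2) + exp (-i lam / 2) = 2 cos (lam / 2)`. -/
theorem sum_localWeight (lam : ℝ) (η : Fin 4 → Bool) :
    (∑ b : Bool, if IsLocallyCoherent η b then
      Complex.exp (Complex.I * lam * ((localTurn η b : ℤ) / 4 : ℂ)) else 0) =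
    if (Finset.univ.filter fun d => η d = false).card = 2 then
      (if ∀ d, η d = !η (d + 1) then 2 * Complex.cos (lam / 2) else 1) else 0 := by
  have hcos : Complex.exp (Complex.I * lam * (2 / 4)) + Complex.exp (Complex.I * lam * (-2 / 4)) =
      2 * Complex.cos (lam / 2) := by
    rw [Complex.two_cos]; ring_nf
  rcases localTurn_cases η with ⟨h1, h2, h3, h4⟩ | ⟨h1, h2, b, h3, h4, h5⟩ | ⟨h1, h2⟩
  · rw [if_pos h1, if_pos h2, Fintype.sum_bool, if_pos (h3 _), if_pos (h3 _), ← hcos]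
    rcases h4 with ⟨e1, e2⟩ | ⟨e1, e2⟩ <;> rw [e1, e2] <;> push_cast
    · rfl
    · rw [add_comm]
  · rw [if_pos h1, if_neg h2, Fintype.sum_bool]
    cases b <;> simp_all
  · simp [h1, h2]

/-- Whether the half-edge of `v` in direction `d` is outgoing in `α`. -/
noncomputable def outgoing (α : Finset (DEdge N₁ N₂)) (v : Vertex N₁ N₂) (d : Fin 4) : Bool :=
  open Classical in decide ((v, d) ∈ α)

theorem outgoing_eq_true {α : Finset (DEdge N₁ N₂)} {v : Vertex N₁ N₂} {d : Fin 4} :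
    outgoing α v d = true ↔ (v, d) ∈ α := by simp [outgoing]

theorem outgoing_eq_false {α : Finset (DEdge N₁ N₂)} {v : Vertex N₁ N₂} {d : Fin 4} :
    outgoing α v d = false ↔ (v, d) ∉ α := by simp [outgoing]

open Classical in
theorem IsOrientation.card_head {α : Finset (DEdge N₁ N₂)} (h : IsOrientation α)
    (v : Vertex N₁ N₂) : (α.filter fun x => x.head = v).card =
      (Finset.univ.filter fun d => outgoing α v d = false).card := by
  refine Finset.card_bij' (fun x _ => x.2 + 2) (fun d _ => DEdge.rev (v, d)) ?_ ?_ ?_ ?_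
  · intro x hx
    simp only [Finset.mem_filter, Finset.mem_univ, true_and, outgoing_eq_false] at hx ⊢
    obtain ⟨hx, rfl⟩ := hx
    have := h.rev_mem_iff x
    rw [DEdge.rev] at this
    tauto
  · intro d hd
    simp only [Finset.mem_filter, Finset.mem_univ, true_and, outgoing_eq_false] at hd ⊢
    exact ⟨(h.rev_mem_iff _).2 hd, DEdge.head_rev _⟩
  · intro x hx
    obtain ⟨-, rfl⟩ := Finset.mem_filter.1 hx
    exact DEdge.rev_rev x
  · intro d _
    simp only [DEdge.rev, add_assoc]
    exact add_zero d

theorem isArrowConfig_iff {α : Finset (DEdge N₁ N₂)} : IsArrowConfig α ↔ IsOrientation α ∧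
    ∀ v, (Finset.univ.filter fun d => outgoing α v d = false).card = 2 := by
  refine and_congr_right fun h => forall_congr' fun v => ?_
  rw [IsOrientation.card_head h]

theorem IsOrientation.isCoherent_iff {α : Finset (DEdge N₁ N₂)} (h : IsOrientation α)
    (L : LoopConfig N₁ N₂) :
    IsCoherent L α ↔ ∀ v, IsLocallyCoherent (outgoing α v) (L v) := by
  have key : ∀ v d, outgoing α v (partner (L v) d) = (!outgoing α v d) ↔
      (next L (DEdge.rev (v, d)) ∈ α ↔ DEdge.rev (v, d) ∈ α) := by
    intro v d
    have e : next L (DEdge.rev (v, d)) = (v, partner (L v) d) := by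
      rw [next, DEdge.head_rev]
      simp only [DEdge.rev, add_assoc]
      rw [show (2 + 2 : Fin 4) = 0 from rfl, add_zero]
    rw [e, h.rev_mem_iff, outgoing, outgoing]
    by_cases h1 : (v, partner (L v) d) ∈ α <;> by_cases h2 : (v, d) ∈ α <;> simp [h1, h2]
  constructor
  · intro hc v d
    exact (key v d).2 (hc _)
  · intro hc x
    have := (key x.head (x.2 + 2)).1 (hc x.head (x.2 + 2))
    rwa [show ((x.head, x.2 + 2) : DEdge N₁ N₂) = x.rev from rfl, DEdge.rev_rev] at this

variable [NeZero N₁] [NeZero N₂]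

theorem IsOrientation.sum_turn {α : Finset (DEdge N₁ N₂)} (h : IsOrientation α)
    (L : LoopConfig N₁ N₂) :
    ∑ x ∈ α, turn L x = ∑ v, localTurn (outgoing α v) (L v) := by
  classical
  have h1 : ∑ x ∈ α, turn L x = ∑ y ∈ Finset.univ.filter (fun y => y ∉ α), turn L y.rev := by
    refine Finset.sum_bij' (fun x _ => x.rev) (fun x _ => x.rev) ?_ ?_
      (fun x _ => DEdge.rev_rev x) (fun x _ => DEdge.rev_rev x) (fun x _ => by rw [DEdge.rev_rev])
    · intro x hx
      simpa [h.rev_mem_iff] using hx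
    · intro x hx
      simpa [h.rev_mem_iff] using hx
  rw [h1, Finset.sum_filter, Fintype.sum_prod_type]
  refine Finset.sum_congr rfl fun v _ => Finset.sum_congr rfl fun d _ => ?_
  have e : turn L (DEdge.rev (v, d)) = if partner (L v) d = d + 3 then 1 else -1 := by
    rw [turn, next, DEdge.head_rev]
    simp only [DEdge.rev, add_assoc]
    rw [show (2 + 2 : Fin 4) = 0 from rfl, add_zero]
    rfl
  rw [e]
  by_cases h2 : (v, d) ∈ α
  · rw [if_neg (not_not.2 h2), if_pos (outgoing_eq_true.2 h2)]
  · rw [if_pos h2, if_neg (mt outgoing_eq_true.1 h2)]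

open Classical in
/-- Summing the winding phases of an orientation of the edges over all loop configurations that are
coherent with it gives the six-vertex weight. -/
theorem sum_phase_coherent (lam : ℝ) {α : Finset (DEdge N₁ N₂)} (h : IsOrientation α) :
    (∑ L : LoopConfig N₁ N₂, if IsCoherent L α then phase lam L α else 0) =
      if IsArrowConfig α then (2 * Complex.cos (lam / 2)) ^ numAlternating α else 0 := by
  have h1 : ∀ L : LoopConfig N₁ N₂, (if IsCoherent L α then phase lam L α else 0) =
      ∏ v, if IsLocallyCoherent (outgoing α v) (L v) then
        Complex.exp (Complex.I * lam * ((localTurn (outgoing α v) (L v) : ℤ) / 4 : ℂ)) else 0 := by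
    intro L
    rw [Finset.prod_ite_zero, h.isCoherent_iff, phase, winding_eq_sum, h.sum_turn,
      ← Complex.exp_sum]
    simp only [Finset.mem_univ, true_imp_iff]
    congr 2
    push_cast
    rw [Finset.sum_div, Finset.mul_sum]
  have h2 := Finset.prod_univ_sum (fun _ : Vertex N₁ N₂ => (Finset.univ : Finset Bool))
    (fun v b => if IsLocallyCoherent (outgoing α v) b then
        Complex.exp (Complex.I * lam * ((localTurn (outgoing α v) b : ℤ) / 4 : ℂ)) else 0)
  rw [Fintype.piFinset_univ] at h2
  rw [Finset.sum_congr rfl fun L _ => h1 L, ← h2,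
    Finset.prod_congr rfl fun v _ => sum_localWeight lam (outgoing α v), Finset.prod_ite_zero,
    isArrowConfig_iff]
  simp only [Finset.mem_univ, true_imp_iff, h, true_and]
  congr 1
  rw [Finset.prod_ite, Finset.prod_const, Finset.prod_const_one, mul_one, numAlternating]
  congr 2
  ext v
  simp only [Finset.mem_filter, Finset.mem_univ, true_and]
  refine forall_congr' fun d => ?_
  rw [outgoing, outgoing]
  by_cases h1 : (v, d) ∈ α <;> by_cases h2 : (v, d + 1) ∈ α <;> simp [h1, h2]

end Weights

/-! ### The loop measure as a sum over arrow configurations -/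

section LoopExpansion

variable {N₁ N₂ : ℕ}

theorem phase_eq_prod (lam : ℝ) (L : LoopConfig N₁ N₂) (o : Finset (DEdge N₁ N₂)) :
    phase lam L o = ∏ x ∈ o, Complex.exp (Complex.I * lam * ((turn L x : ℤ) / 4 : ℂ)) := by
  rw [phase, winding_eq_sum, ← Complex.exp_sum]
  congr 1
  push_cast
  rw [Finset.sum_div, Finset.mul_sum]

open Classical in
theorem epsilon_eq_prod (Γ : Multiset (DEdge N₁ N₂)) (H : Finset (DEdge N₁ N₂)) :
    epsilon Γ H = ∏ x ∈ H, Complex.I ^ Γ.count x * (-Complex.I) ^ Γ.count x.rev := by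
  have h1 : ∀ H : Finset (DEdge N₁ N₂), Γ.countP (fun x => x ∈ H) = ∑ x ∈ H, Γ.count x := by
    intro H
    rw [Multiset.countP_eq_card_filter,
      ← Multiset.sum_count_eq_card (s := H) (m := Γ.filter fun x => x ∈ H) (by simp)]
    exact Finset.sum_congr rfl fun x hx => Multiset.count_filter_of_pos hx
  rw [epsilon, h1, h1, reverse, Finset.sum_image DEdge.rev_injective.injOn, Finset.prod_mul_distrib,
    Finset.prod_pow_eq_pow_sum, Finset.prod_pow_eq_pow_sum]

theorem prod_reverse (o : Finset (DEdge N₁ N₂)) (G : DEdge N₁ N₂ → ℂ) :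
    ∏ x ∈ reverse o, G x = ∏ x ∈ o, G x.rev := by
  rw [reverse, Finset.prod_image DEdge.rev_injective.injOn]

theorem isContractible_mk (o : Finset (DEdge N₁ N₂)) :
    IsContractible s(o, reverse o) ↔ displacement o = 0 := by
  simp [IsContractible, displacement_reverse]

variable [NeZero N₁] [NeZero N₂] {black : Set (Face N₁ N₂)}

theorem winding_reverse (L : LoopConfig N₁ N₂) (x : DEdge N₁ N₂) :
    winding L (reverse (orientedLoop L x)) = -winding L (orientedLoop L x) := by
  classical
  rw [winding_eq_sum, winding_eq_sum, reverse, Finset.sum_image DEdge.rev_injective.injOn,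
    sum_turn_rev]
  push_cast
  ring

/-- A contractible loop winds around once, in one of the two senses, and a noncontractible one does
not wind around in total. -/
theorem phase_add_phase_reverse (hblack : IsChessboard black) (lam : ℝ) (L : LoopConfig N₁ N₂)
    (x : DEdge N₁ N₂) :
    phase lam L (orientedLoop L x) + phase lam L (reverse (orientedLoop L x)) =
      if displacement (orientedLoop L x) = 0 then 2 * Complex.cos lam else 2 := by
  have h := sum_turn_orientedLoop hblack L x
  rw [phase, phase, winding_reverse, winding_eq_sum]
  split_ifs with h0
  · rw [Complex.two_cos]
    rcases h.1 h0 with e | e <;> rw [e] <;> push_cast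
    · ring_nf
    · rw [add_comm]; ring_nf
  · rw [h.2 h0]
    norm_num

/-- The winding of a loop is an integer. -/
theorem phase_add_two_pi (hblack : IsChessboard black) (lam : ℝ) (L : LoopConfig N₁ N₂)
    (x : DEdge N₁ N₂) :
    phase (lam + 2 * Real.pi) L (orientedLoop L x) = phase lam L (orientedLoop L x) := by
  obtain ⟨n, hn⟩ : ∃ n : ℤ, ∑ y ∈ orientedLoop L x, turn L y = 4 * n := by
    have h := sum_turn_orientedLoop hblack L x
    by_cases h0 : displacement (orientedLoop L x) = 0
    · rcases h.1 h0 with e | e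
      · exact ⟨1, by rw [e]; rfl⟩
      · exact ⟨-1, by rw [e]; rfl⟩
    · exact ⟨0, by rw [h.2 h0]; rfl⟩
  rw [phase, phase, winding_eq_sum, hn]
  push_cast
  rw [show Complex.I * ((lam : ℂ) + 2 * Real.pi) * (4 * (n : ℂ) / 4) =
    Complex.I * lam * (4 * (n : ℂ) / 4) + n * (2 * Real.pi * Complex.I) by ring, Complex.exp_add,
    Complex.exp_int_mul_two_pi_mul_I, mul_one]

theorem prod_rho_add_two_pi (hblack : IsChessboard black) (lam : ℝ) (Γ : Multiset (DEdge N₁ N₂))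
    (L : LoopConfig N₁ N₂) :
    ∏ l ∈ loops L, rho (lam + 2 * Real.pi) Γ L l = ∏ l ∈ loops L, rho lam Γ L l := by
  refine Finset.prod_congr rfl fun l hl => ?_
  simp only [loops, Finset.mem_image, Finset.mem_univ, true_and] at hl
  obtain ⟨x, rfl⟩ := hl
  simp only [rho, Sym2.lift_mk, reverse_orientedLoop, phase_add_two_pi hblack]

open Classical in
/-- The loop mass is a product of the total winding phases of the two orientations of each loop. -/
theorem loopMass_eq {c : ℝ} (hc : √(clusterParam c) ≠ 0) (hblack : IsChessboard black) {lam : ℝ}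
    (hlam : √(clusterParam c) = 2 * Real.cos lam) (L : LoopConfig N₁ N₂) :
    (loopMass c L : ℂ) = (∏ o ∈ blackLeftLoops black L,
      (phase lam L o + phase lam L (reverse o))) / (partitionFunction N₁ N₂ c : ℂ) := by
  rw [loopMass]
  push_cast
  congr 1
  rw [← Finset.prod_const, ← Finset.prod_const, nctrLoops, Finset.prod_filter,
    ← Finset.prod_mul_distrib, prod_loops hblack]
  refine Finset.prod_congr rfl fun o ho => ?_
  obtain ⟨x, -, rfl⟩ := mem_blackLeftLoops.1 ho
  rw [isContractible_mk, phase_add_phase_reverse hblack, ite_not]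
  split_ifs with h
  · rw [mul_one, hlam]; push_cast; rfl
  · rw [mul_div_cancel₀ _ (by exact_mod_cast hc)]

open Classical in
/-- The expectation of the loop observable as a sum over arrow configurations. -/
theorem loopExp_rho {c : ℝ} (hc : √(clusterParam c) ≠ 0) (hblack : IsChessboard black) {lam : ℝ}
    (hlam : √(clusterParam c) = 2 * Real.cos lam) (Γ : Multiset (DEdge N₁ N₂)) :
    loopExp c (fun L : LoopConfig N₁ N₂ => ∏ l ∈ loops L, rho lam Γ L l) =
      (∑ α ∈ arrowConfigs N₁ N₂, (2 * Complex.cos (lam / 2)) ^ numAlternating α * epsilon Γ α) /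
        (partitionFunction N₁ N₂ c : ℂ) := by
  set E : DEdge N₁ N₂ → ℂ :=
    fun x => Complex.I ^ Γ.count x * (-Complex.I) ^ Γ.count x.rev with hE
  have hL : ∀ L : LoopConfig N₁ N₂, (loopMass c L : ℂ) * ∏ l ∈ loops L, rho lam Γ L l =
      (∑ α ∈ Finset.univ.filter (fun α : Finset (DEdge N₁ N₂) => IsOrientation α),
        (if IsCoherent L α then phase lam L α else 0) * epsilon Γ α) /
          (partitionFunction N₁ N₂ c : ℂ) := by
    intro L
    rw [loopMass_eq hc hblack hlam, prod_loops hblack, div_mul_eq_mul_div,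
      ← Finset.prod_mul_distrib]
    congr 1
    have h1 := prod_add_eq_sum_coherent hblack L
      (fun x => Complex.exp (Complex.I * lam * ((turn L x : ℤ) / 4 : ℂ)) * E x)
    have h2 : ∀ o : Finset (DEdge N₁ N₂),
        ∏ x ∈ o, Complex.exp (Complex.I * lam * ((turn L x : ℤ) / 4 : ℂ)) * E x =
          phase lam L o * epsilon Γ o := by
      intro o
      rw [Finset.prod_mul_distrib, ← phase_eq_prod, ← epsilon_eq_prod]
    rw [← Finset.filter_filter, Finset.sum_filter] at h1
    refine Eq.trans (Finset.prod_congr rfl fun o ho => ?_) (h1.trans (Finset.sum_congr rfl ?_))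
    · obtain ⟨x, -, rfl⟩ := mem_blackLeftLoops.1 ho
      rw [← prod_reverse (orientedLoop L x)
        (fun x => Complex.exp (Complex.I * lam * ((turn L x : ℤ) / 4 : ℂ)) * E x), h2, h2, rho,
        Sym2.lift_mk]
      refine mul_div_cancel₀ _ ?_
      rw [phase_add_phase_reverse hblack]
      split_ifs
      · rw [hlam] at hc
        exact_mod_cast hc
      · exact two_ne_zero
    · intro α _
      rw [h2, ite_mul, zero_mul]
  rw [loopExp, Finset.sum_congr rfl fun L _ => hL L, ← Finset.sum_div, Finset.sum_comm]
  congr 1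
  rw [Finset.sum_congr rfl fun α hα => by
    rw [← Finset.sum_mul, sum_phase_coherent lam (Finset.mem_filter.1 hα).2, ite_mul, zero_mul],
    ← Finset.sum_filter, Finset.filter_filter, arrowConfigs]
  refine Finset.sum_congr ?_ fun _ _ => rfl
  ext α
  simp only [Finset.mem_filter, Finset.mem_univ, true_and]
  exact ⟨fun h => h.2, fun h => ⟨h.1, h⟩⟩

end LoopExpansion

/-! ### The height function -/

section Height

variable {N₁ N₂ : ℕ}

open Classical in
/-- `1` if the arrow on the edge of `x` points in the direction of `x`, and `-1` otherwise. -/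
noncomputable def arrowSign (α : Finset (DEdge N₁ N₂)) (x : DEdge N₁ N₂) : ℤ :=
  if x ∈ α then 1 else -1

theorem IsOrientation.arrowSign_rev {α : Finset (DEdge N₁ N₂)} (h : IsOrientation α)
    (x : DEdge N₁ N₂) : arrowSign α x.rev = -arrowSign α x := by
  by_cases hx : x ∈ α <;> simp [arrowSign, h.rev_mem_iff, hx]

/-- The flux of `α` through the step from the face `f` in direction `d`. -/
noncomputable def stepFlux (α : Finset (DEdge N₁ N₂)) (f : Face N₁ N₂) (d : Fin 4) : ℤ :=
  arrowSign α (crossedEdge f d)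

theorem DualPath.flux_nil (f : Face N₁ N₂) (α : Finset (DEdge N₁ N₂)) :
    (DualPath.nil f).flux α = 0 := by
  simp [flux, crossings]

theorem DualPath.flux_cons {α : Finset (DEdge N₁ N₂)} (h : IsOrientation α) {f g : Face N₁ N₂}
    {d : Fin 4} (hd : ¬ CrossesCut f d) (p : DualPath N₁ N₂ (move f d) g) :
    (DualPath.cons f d g hd p).flux α = stepFlux α f d + p.flux α := by
  classical
  simp only [flux, crossings, Multiset.countP_cons, stepFlux, arrowSign, h.rev_mem_iff]
  split_ifs <;> push_cast <;> ring

/-- The six-vertex rule says that the flux out of a vertex vanishes. -/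
theorem IsArrowConfig.sum_out_eq_zero {α : Finset (DEdge N₁ N₂)} (h : IsArrowConfig α)
    (v : Vertex N₁ N₂) : ∑ d : Fin 4, arrowSign α (v, d) = 0 := by
  have h2 := (isArrowConfig_iff.1 h).2 v
  have e : ∀ d, arrowSign α (v, d) = if outgoing α v d = true then 1 else -1 := fun d => by
    simp [arrowSign, outgoing]
  simp only [e]
  revert h2
  generalize outgoing α v = η
  revert η
  decide

theorem crossedEdge_move (f : Face N₁ N₂) (d : Fin 4) :
    crossedEdge (move f d) (d + 2) = (crossedEdge f d).rev := by
  obtain ⟨x, y⟩ := f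
  fin_cases d <;> simp [crossedEdge, move, unitVec, DEdge.rev, DEdge.head]

theorem stepFlux_move {α : Finset (DEdge N₁ N₂)} (h : IsOrientation α) (f : Face N₁ N₂)
    (d : Fin 4) : stepFlux α (move f d) (d + 2) = -stepFlux α f d := by
  rw [stepFlux, stepFlux, crossedEdge_move, h.arrowSign_rev]

/-- The flux around a vertex vanishes. -/
theorem IsArrowConfig.stepFlux_square {α : Finset (DEdge N₁ N₂)} (h : IsArrowConfig α)
    (x : ZMod (2 * N₁)) (y : ZMod (2 * N₂)) :
    stepFlux α (x, y) 0 + stepFlux α (x + 1, y) 1 =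
      stepFlux α (x, y) 1 + stepFlux α (x, y + 1) 0 := by
  have ho := (isArrowConfig_iff.1 h).1
  have key := h.sum_out_eq_zero (x + 1, y + 1)
  rw [Fin.sum_univ_four] at key
  have e₁ : crossedEdge (x, y) 0 = DEdge.rev ((x + 1, y + 1), 3) := by
    simp [crossedEdge, DEdge.rev, DEdge.head, move, unitVec]
  have e₂ : crossedEdge (x + 1, y) 1 = DEdge.rev ((x + 1, y + 1), 0) := by
    simp [crossedEdge, DEdge.rev, DEdge.head, move, unitVec]
  have e₃ : crossedEdge (x, y) 1 = ((x + 1, y + 1), 2) := by simp [crossedEdge]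
  have e₄ : crossedEdge (x, y + 1) 0 = ((x + 1, y + 1), 1) := by simp [crossedEdge]
  rw [stepFlux, stepFlux, stepFlux, stepFlux, e₁, e₂, e₃, e₄, ho.arrowSign_rev, ho.arrowSign_rev]
  linarith

theorem val_add_one {n : ℕ} [NeZero n] {a : ZMod n} (h : a ≠ -1) : (a + 1).val = a.val + 1 := by
  have hlt : a.val + 1 < n := by
    by_contra hcon
    apply h
    have e : a.val + 1 = n := le_antisymm (ZMod.val_lt a) (not_lt.1 hcon)
    rw [eq_neg_iff_add_eq_zero, ← ZMod.natCast_zmod_val a]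
    exact_mod_cast (congrArg (Nat.cast : ℕ → ZMod n) e).trans (ZMod.natCast_self n)
  rw [← ZMod.val_natCast_of_lt hlt]
  push_cast
  rw [ZMod.natCast_zmod_val]

theorem neg_natCast_half (N : ℕ) : -(N : ZMod (2 * N)) = N := by
  have h2 : ((2 * N : ℕ) : ZMod (2 * N)) = 0 := ZMod.natCast_self _
  push_cast at h2
  linear_combination -h2

/-- Heights change by one between adjacent faces, which have different colours. -/
theorem DualPath.even_flux {α : Finset (DEdge N₁ N₂)} (h : IsOrientation α)
    {black : Set (Face N₁ N₂)} (hblack : IsChessboard black) {f g : Face N₁ N₂}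
    (p : DualPath N₁ N₂ f g) : Even (p.flux α) ↔ (f ∈ black ↔ g ∈ black) := by
  induction p with
  | nil f => simp [DualPath.flux_nil]
  | cons f d g hd p ih =>
    have hodd : ¬ Even (stepFlux α f d) := by
      unfold stepFlux arrowSign; split_ifs <;> decide
    rw [DualPath.flux_cons h, Int.even_add, ih, hblack]
    tauto

theorem epsilon_sum {ι : Type*} (s : Finset ι) (Γ : ι → Multiset (DEdge N₁ N₂))
    (H : Finset (DEdge N₁ N₂)) : epsilon (∑ i ∈ s, Γ i) H = ∏ i ∈ s, epsilon (Γ i) H := by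
  classical
  induction s using Finset.induction_on with
  | empty => simp [epsilon]
  | insert i s hi ih =>
    rw [Finset.sum_insert hi, Finset.prod_insert hi, ← ih]
    simp only [epsilon, Multiset.countP_add, pow_add]
    ring

theorem epsilon_crossings (α : Finset (DEdge N₁ N₂)) {f g : Face N₁ N₂}
    (p : DualPath N₁ N₂ f g) : epsilon p.crossings α = Complex.I ^ p.flux α := by
  classical
  rw [epsilon, DualPath.flux, zpow_sub₀ Complex.I_ne_zero, zpow_natCast, zpow_natCast,
    div_eq_mul_inv, ← inv_pow, Complex.inv_I]
  simp only [mem_reverse]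

variable [NeZero N₁] [NeZero N₂]

/-- A discrete vector field without curl is a gradient on the box. -/
theorem exists_potential {s t : ZMod (2 * N₁) → ZMod (2 * N₂) → ℤ}
    (h : ∀ x y, s x y + t (x + 1) y = t x y + s x (y + 1)) :
    ∃ φ : ZMod (2 * N₁) → ZMod (2 * N₂) → ℤ,
      (∀ x y, x ≠ (N₁ : ZMod (2 * N₁)) → φ (x + 1) y = φ x y + s x y) ∧
      ∀ x y, y ≠ (N₂ : ZMod (2 * N₂)) → φ x (y + 1) = φ x y + t x y := by
  -- integrate along the bottom row of the box first, then along a column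
  refine ⟨fun x y =>
    ∑ i ∈ Finset.range (x + N₁ - 1).val, s (i - N₁ + 1) (-N₂ + 1) +
      ∑ j ∈ Finset.range (y + N₂ - 1).val, t x (j - N₂ + 1), ?_, ?_⟩
  · intro x y hx
    have e : (x + 1 + N₁ - 1).val = (x + N₁ - 1).val + 1 := by
      rw [← val_add_one]
      · congr 1; ring
      · intro h'
        apply hx
        rw [← neg_natCast_half]
        linear_combination h'
    have hcol : ∀ k : ℕ, ∑ j ∈ Finset.range k, t (x + 1) (j - N₂ + 1) + s x (-N₂ + 1) =
        ∑ j ∈ Finset.range k, t x (j - N₂ + 1) + s x (k - N₂ + 1) := by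
      intro k
      induction k with
      | zero => simp
      | succ k ih =>
        rw [Finset.sum_range_succ, Finset.sum_range_succ]
        have := h x (k - N₂ + 1)
        have e : ((k + 1 : ℕ) : ZMod (2 * N₂)) - N₂ + 1 = k - N₂ + 1 + 1 := by push_cast; ring
        rw [e]
        linarith
    have h1 := hcol (y + N₂ - 1).val
    have ex : (((x + N₁ - 1).val : ℕ) : ZMod (2 * N₁)) - N₁ + 1 = x := by
      rw [ZMod.natCast_zmod_val]; ring
    have ey : (((y + N₂ - 1).val : ℕ) : ZMod (2 * N₂)) - N₂ + 1 = y := by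
      rw [ZMod.natCast_zmod_val]; ring
    rw [ey] at h1
    beta_reduce
    rw [e, Finset.sum_range_succ, ex]
    linarith
  · intro x y hy
    have e : (y + 1 + N₂ - 1).val = (y + N₂ - 1).val + 1 := by
      rw [← val_add_one]
      · congr 1; ring
      · intro h'
        apply hy
        rw [← neg_natCast_half]
        linear_combination h'
    have ey : (((y + N₂ - 1).val : ℕ) : ZMod (2 * N₂)) - N₂ + 1 = y := by
      rw [ZMod.natCast_zmod_val]; ring
    beta_reduce
    rw [e, Finset.sum_range_succ, ey]
    ring

theorem IsArrowConfig.exists_potential {α : Finset (DEdge N₁ N₂)} (h : IsArrowConfig α) :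
    ∃ φ : Face N₁ N₂ → ℤ, ∀ f d, ¬ CrossesCut f d → φ (move f d) = φ f + stepFlux α f d := by
  have ho := (isArrowConfig_iff.1 h).1
  obtain ⟨φ, h₁, h₂⟩ := SixVertex.exists_potential
    (s := fun x y => stepFlux α (x, y) 0) (t := fun x y => stepFlux α (x, y) 1) h.stepFlux_square
  refine ⟨fun f => φ f.1 f.2, ?_⟩
  rintro ⟨x, y⟩ d hd
  fin_cases d
  · have := h₁ x y (by simpa [CrossesCut] using hd)
    simpa [move_zero] using this
  · have := h₂ x y (by simpa [CrossesCut] using hd)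
    simpa [move_one] using this
  · have e := h₁ (x - 1) y (by
      rw [← neg_natCast_half]
      simp [CrossesCut] at hd
      intro h'
      exact hd (by rw [← h']; ring))
    have e' := stepFlux_move ho (x, y) 2
    simp [move_two] at e e' ⊢
    change stepFlux α (x - 1, y) 0 = _ at e'
    linarith
  · have e := h₂ x (y - 1) (by
      rw [← neg_natCast_half]
      simp [CrossesCut] at hd
      intro h'
      exact hd (by rw [← h']; ring))
    have e' := stepFlux_move ho (x, y) 3
    simp [move_three] at e e' ⊢
    change stepFlux α (x, y - 1) 1 = _ at e'
    linarith

/-- The height function does not depend on the choice of paths. -/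
theorem IsArrowConfig.height_sub_height {α : Finset (DEdge N₁ N₂)} (h : IsArrowConfig α)
    (u₀ : Face N₁ N₂) (b : ℤ) {f g : Face N₁ N₂} (p : DualPath N₁ N₂ f g) :
    height u₀ α b g - height u₀ α b f = p.flux α := by
  obtain ⟨φ, hφ⟩ := h.exists_potential
  have key : ∀ {f g : Face N₁ N₂} (p : DualPath N₁ N₂ f g), p.flux α = φ g - φ f := by
    intro f g p
    induction p with
    | nil f => rw [DualPath.flux_nil, sub_self]
    | cons f d g hd p ih => rw [DualPath.flux_cons (isArrowConfig_iff.1 h).1, ih, hφ f d hd]; ring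
  simp only [height, key]
  ring

theorem even_height {α : Finset (DEdge N₁ N₂)} (h : IsOrientation α)
    {black : Set (Face N₁ N₂)} (hblack : IsChessboard black) {u₀ : Face N₁ N₂} (hu₀ : u₀ ∉ black)
    {b : ℤ} (hb : ¬ Even b) (f : Face N₁ N₂) : Even (height u₀ α b f) ↔ f ∈ black := by
  rw [height, Int.even_add, DualPath.even_flux h hblack]
  tauto

open Classical in
/-- The spins at the two ends of a path. The heights are odd at white faces, where
`i ^ h = -i ^ (-h)`, and even at black faces, where `i ^ h = i ^ (-h)`. -/
theorem spin_mul_spin {α : Finset (DEdge N₁ N₂)} (h : IsArrowConfig α)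
    {black : Set (Face N₁ N₂)} (hblack : IsChessboard black) {u₀ : Face N₁ N₂} (hu₀ : u₀ ∉ black)
    {b : ℤ} (hb : ¬ Even b) {f g : Face N₁ N₂} (p : DualPath N₁ N₂ f g) :
    spin u₀ α b f * spin u₀ α b g =
      (if f ∈ black then 1 else -1) * epsilon p.crossings α := by
  have e : height u₀ α b f + height u₀ α b g = 2 * height u₀ α b f + p.flux α := by
    rw [← h.height_sub_height u₀ b p]; ring
  rw [spin, spin, ← zpow_add₀ Complex.I_ne_zero, e, zpow_add₀ Complex.I_ne_zero,
    epsilon_crossings, zpow_mul]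
  congr 1
  rw [show (Complex.I ^ (2 : ℤ)) = -1 by
    rw [show (2 : ℤ) = ((2 : ℕ) : ℤ) from rfl, zpow_natCast, Complex.I_sq]]
  have hev := even_height (isArrowConfig_iff.1 h).1 hblack hu₀ hb f
  split_ifs with hf
  · exact (hev.2 hf).neg_one_zpow
  · exact (Int.not_even_iff_odd.1 (mt hev.1 hf)).neg_one_zpow

/-- The product of the spins at the sources and sinks of a zipper. -/
theorem prod_spin {k l m : ℕ} {α : Finset (DEdge N₁ N₂)} (h : IsArrowConfig α)
    {black : Set (Face N₁ N₂)} (hblack : IsChessboard black) {u₀ : Face N₁ N₂} (hu₀ : u₀ ∉ black)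
    {b : ℤ} (hb : ¬ Even b)
    {u : Fin k → Face N₁ N₂} (hu : ∀ i, u i ∈ black)
    {v : Fin (2 * l) → Face N₁ N₂} (hv : ∀ j, v j ∉ black)
    (e : Fin m ⊕ Fin m ≃ Fin k ⊕ Fin (2 * l))
    (γ : ∀ i : Fin m, DualPath N₁ N₂ (Sum.elim u v (e (Sum.inl i))) (Sum.elim u v (e (Sum.inr i)))) :
    (∏ i, spin u₀ α b (u i)) * ∏ j, spin u₀ α b (v j) =
      (-1) ^ (Finset.univ.filter fun i : Fin m => (e (Sum.inr i)).isRight = true).card *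
        epsilon (zipper γ) α := by
  classical
  have h1 : (∏ i, spin u₀ α b (u i)) * ∏ j, spin u₀ α b (v j) =
      ∏ a, spin u₀ α b (Sum.elim u v (e a)) := by
    rw [Equiv.prod_comp e (fun a => spin u₀ α b (Sum.elim u v a)), Fintype.prod_sum_type]
    rfl
  have hblk : ∀ a, Sum.elim u v a ∈ black ↔ ¬ a.isRight = true := by
    rintro (a | a)
    · simp [hu]
    · simp [hv]
  -- the number of white faces is even, so white sources and white sinks give the same sign
  have hsign : (∏ i : Fin m, if (e (Sum.inl i)).isRight = true then (-1 : ℂ) else 1) *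
      ∏ i : Fin m, (if (e (Sum.inr i)).isRight = true then (-1 : ℂ) else 1) = 1 := by
    have := Equiv.prod_comp e (fun a => if a.isRight = true then (-1 : ℂ) else 1)
    rw [Fintype.prod_sum_type, Fintype.prod_sum_type] at this
    rw [this]
    simp
  have hsink : ∏ i : Fin m, (if (e (Sum.inr i)).isRight = true then (-1 : ℂ) else 1) =
      (-1) ^ (Finset.univ.filter fun i : Fin m => (e (Sum.inr i)).isRight = true).card := by
    rw [Finset.prod_ite, Finset.prod_const, Finset.prod_const_one, mul_one]
  rw [h1, Fintype.prod_sum_type, ← Finset.prod_mul_distrib,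
    Finset.prod_congr rfl fun i _ => spin_mul_spin h hblack hu₀ hb (γ i), Finset.prod_mul_distrib,
    zipper, epsilon_sum]
  congr 1
  simp only [hblk, ite_not]
  rw [hsink] at hsign
  rcases neg_one_pow_eq_or ℂ
    (Finset.univ.filter fun i : Fin m => (e (Sum.inr i)).isRight = true).card with h2 | h2 <;>
    rw [h2] at hsign ⊢
  · linear_combination hsign
  · linear_combination -hsign

end Height

end SixVertex

theorem lemma2p1 (n j₁ j₂ : ℕ) [NeZero n] [NeZero j₁] [NeZero j₂]
    (c : ℝ) (hc : √3 ≤ c) (hc' : c ≤ 2)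
    (lam : ℝ) (hlam : √(SixVertex.clusterParam c) = 2 * Real.cos lam)
    -- the chessboard colouring and the white reference face of the height function
    (black : Set (SixVertex.Face (n * j₁) (n * j₂))) (hblack : SixVertex.IsChessboard black)
    (u₀ : SixVertex.Face (n * j₁) (n * j₂)) (hu₀ : u₀ ∉ black)
    -- the black faces `u₁, …, u₂ₖ` and the white faces `v₁, …, v₂ₗ`
    (k l : ℕ)
    (u : Fin (2 * k) → SixVertex.Face (n * j₁) (n * j₂)) (hu : ∀ i, u i ∈ black)
    (v : Fin (2 * l) → SixVertex.Face (n * j₁) (n * j₂)) (hv : ∀ j, v j ∉ black)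
    -- the division into sources `e (inl i)` and sinks `e (inr i)`, and the paths joining them
    (e : Fin (k + l) ⊕ Fin (k + l) ≃ Fin (2 * k) ⊕ Fin (2 * l))
    (γ : ∀ i : Fin (k + l), SixVertex.DualPath (n * j₁) (n * j₂)
      (Sum.elim u v (e (Sum.inl i))) (Sum.elim u v (e (Sum.inr i))))
    -- the number of white sinks
    (s : ℕ) (hs : s = (Finset.univ.filter fun i : Fin (k + l) =>
      (e (Sum.inr i)).isRight = true).card) :
    SixVertex.sixVertexExp c (fun α b =>
        (∏ i, SixVertex.spin u₀ α b (u i)) * ∏ j, SixVertex.spin u₀ α b (v j)) =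
      (-1) ^ s * SixVertex.loopExp c (fun L =>
        ∏ ℓ ∈ SixVertex.loops L, SixVertex.rho lam (SixVertex.zipper γ) L ℓ) := by
  classical
  have hc3 : 3 ≤ c ^ 2 := by
    have h0 := Real.sqrt_nonneg 3
    have := Real.sq_sqrt (show (0 : ℝ) ≤ 3 by norm_num)
    nlinarith
  have hc0 : 0 ≤ c := (Real.sqrt_nonneg 3).trans hc
  have hq : √(SixVertex.clusterParam c) = c ^ 2 - 2 := Real.sqrt_sq (by linarith)
  have hq0 : √(SixVertex.clusterParam c) ≠ 0 := by rw [hq]; linarith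
  -- the two signs of `cos (lam / 2)` are exchanged by adding `2 π` to `lam`
  obtain ⟨lam', hlam', hcos, hrho⟩ : ∃ lam' : ℝ,
      √(SixVertex.clusterParam c) = 2 * Real.cos lam' ∧ 2 * Real.cos (lam' / 2) = c ∧
      ∀ L, ∏ ℓ ∈ SixVertex.loops L, SixVertex.rho lam (SixVertex.zipper γ) L ℓ =
        ∏ ℓ ∈ SixVertex.loops L, SixVertex.rho lam' (SixVertex.zipper γ) L ℓ := by
    have h2 : (2 * Real.cos (lam / 2)) ^ 2 = c ^ 2 := by
      have := Real.cos_sq (lam / 2)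
      rw [show 2 * (lam / 2) = lam by ring] at this
      rw [mul_pow, this]
      linarith
    rcases sq_eq_sq_iff_eq_or_eq_neg.1 h2 with h2 | h2
    · exact ⟨lam, hlam, h2, fun _ => rfl⟩
    · refine ⟨lam + 2 * Real.pi, by rw [Real.cos_add_two_pi, hlam], ?_,
        fun L => (SixVertex.prod_rho_add_two_pi hblack lam _ L).symm⟩
      rw [show (lam + 2 * Real.pi) / 2 = lam / 2 + Real.pi by ring, Real.cos_add_pi]
      linarith
  have hcos' : 2 * Complex.cos ((lam' : ℂ) / 2) = c := by
    rw [← hcos]; push_cast; rfl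
  simp only [hrho]
  rw [SixVertex.loopExp_rho hq0 hblack hlam', hcos', SixVertex.sixVertexExp, mul_div_assoc',
    Finset.mul_sum, Finset.sum_div]
  refine Finset.sum_congr rfl fun α hα => ?_
  have hα' : SixVertex.IsArrowConfig α := (Finset.mem_filter.1 hα).2
  rw [Finset.sum_pair (by decide),
    SixVertex.prod_spin hα' hblack hu₀ (b := 1) (by decide) hu hv e γ,
    SixVertex.prod_spin hα' hblack hu₀ (b := -1) (by decide) hu hv e γ, ← hs]
  push_cast
  ring
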